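/- For a real $m\times n$ matrix $A$, let $\gamma_2(A)=\min_{A=UV}\|U\|_{\mathrm{row}}\|V\|_{\mathrm{col}}$, where the minimum is over all factorizations $A=UV$ into real matrices (of any finite inner dimension), $\|U\|_{\mathrm{row}}$ is the maximum $\ell^2$-norm of a row of $U$, and $\|V\|_{\mathrm{col}}$ is the maximum $\ell^2$-norm of a column of $V$. There are an absolute constant $C>0$ and, for every real $\lambda$, a number $c_\lambda\ge 1/2^{2^{C\lambda}}$ depending only on $\lambda$, such that the following holds. Let $A$ be an $m\times n$ boolean matrix (all entries in $\{0,1\}$) with $\gamma_2(A)\le\lambda$, and let $F$ be the number of its $1$-entries. Then there are a set $S$ of rows and a set $T$ of columns such that $A(i,j)=1$ for all $(i,j)\in S\times T$ (that is, $S\times T$ is a $1$-rectangle), and $$|S|\ge \frac{c_\lambda F}{n},\qquad |T|\ge \frac{c_\lambda F}{m}.$$ (If $F=0$, the rectangle may be empty.) -/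

import Mathlib

noncomputable section

/-- The maximum Euclidean norm of a row of `U` (zero if there are no rows). -/
def rowNorm {m k : ℕ} (U : Matrix (Fin m) (Fin k) ℝ) : ℝ :=
  ⨆ i : Fin m, ‖WithLp.toLp 2 (fun l : Fin k => U i l)‖

/-- The maximum Euclidean norm of a column of `V` (zero if there are no columns). -/
def colNorm {k n : ℕ} (V : Matrix (Fin k) (Fin n) ℝ) : ℝ :=
  ⨆ j : Fin n, ‖WithLp.toLp 2 (fun l : Fin k => V l j)‖

/-- The values `rowNorm U * colNorm V` over all factorizations `A = U * V`, with arbitrary finite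
inner dimension `k`. -/
def factorizationValues {m n : ℕ} (A : Matrix (Fin m) (Fin n) ℝ) : Set ℝ :=
  {r | ∃ (k : ℕ) (U : Matrix (Fin m) (Fin k) ℝ) (V : Matrix (Fin k) (Fin n) ℝ),
    A = U * V ∧ r = rowNorm U * colNorm V}

/-- The `γ₂` factorization norm of a real matrix. The infimum is over a nonempty set of
nonnegative reals, see below. -/
def gammaTwo {m n : ℕ} (A : Matrix (Fin m) (Fin n) ℝ) : ℝ :=
  sInf (factorizationValues A)

theorem factorizationValues_nonempty {m n : ℕ} (A : Matrix (Fin m) (Fin n) ℝ) :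
    (factorizationValues A).Nonempty :=
  ⟨_, n, A, 1, by simp, rfl⟩

theorem factorizationValues_bddBelow {m n : ℕ} (A : Matrix (Fin m) (Fin n) ℝ) :
    BddBelow (factorizationValues A) := by
  refine ⟨0, ?_⟩
  rintro r ⟨k, U, V, -, rfl⟩
  exact mul_nonneg (Real.iSup_nonneg fun _ => norm_nonneg _)
    (Real.iSup_nonneg fun _ => norm_nonneg _)

/-- A boolean matrix: all entries are `0` or `1`. -/
def IsBoolean {m n : ℕ} (A : Matrix (Fin m) (Fin n) ℝ) : Prop :=
  ∀ i j, A i j = 0 ∨ A i j = 1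

/-- The number of entries of `A` that are equal to `1`. -/
def numOnes {m n : ℕ} (A : Matrix (Fin m) (Fin n) ℝ) : ℕ :=
  (Finset.univ.filter fun p : Fin m × Fin n => A p.1 p.2 = 1).card

/-- `S × T` is a `1`-rectangle of `A`: all entries of `A` in the rows `S` and columns `T` are
equal to `1`. -/
def IsOneRectangle {m n : ℕ} (A : Matrix (Fin m) (Fin n) ℝ)
    (S : Finset (Fin m)) (T : Finset (Fin n)) : Prop :=
  ∀ i ∈ S, ∀ j ∈ T, A i j = 1

end

/-! The engine is an energy decrement. Rows and columns are vectors of squared norm at most `L`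
whose inner products are the matrix entries. If a family `N` of row vectors all have inner product
at least 1/2 with one column vector, their mean has squared norm at least 1/(4L), and subtracting it
shortens a positive proportion of the family by 1/(8L) in squared norm
(`exists_subset_norm_sub_mean_le`). On a column where few rows of `N` have a 1, the mean has small
inner product, so the shifted vectors still approximate the matrix there. Only O(L²) decrements fit,
so tolerances and set sizes may worsen by a fixed factor each time.

Dense rectangle (`exists_dense_rectangle`): let `N` consist of rows with a 1 in a given column. If
many columns are dense on `N`, they form the rectangle. Otherwise some row of `N` can be shortened
outside a few columns. Without any dense rectangle, most 1-entries would survive every round until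
the vectors vanish, which is absurd.

Empty rectangle (`exists_empty_rectangle`): in a sparse relation, clusters of rows and of columns
are shortened until what is left has no related pair, or a positive proportion of one side has been
shortened and the argument repeats.

Combination (`exists_full_rectangle`): a dense rectangle has only constant density, so
`exists_subset_almost_constant` first passes to columns on which every row is nearly constant.
Keeping the nearly full rows makes the complement sparse. The complement is factorized with one
extra coordinate, and an empty rectangle of it is a 1-rectangle. The total loss is 2^(O(L⁶)), well
inside the double exponential. -/

/-! ### Energy decrement by subtracting a mean -/

theorem inner_mean {ι E : Type*} [NormedAddCommGroup E] [InnerProductSpace ℝ E]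
    (N : Finset ι) (u : ι → E) (w : E) :
    inner ℝ ((N.card : ℝ)⁻¹ • ∑ k ∈ N, u k) w = (N.card : ℝ)⁻¹ * ∑ k ∈ N, inner ℝ (u k) w := by
  rw [real_inner_smul_left, sum_inner]

/-- If all vectors of a finite family correlate with one vector, then subtracting the mean of the
family decreases the norm of a positive proportion of them. -/
theorem exists_subset_norm_sub_mean_le {ι E : Type*} [NormedAddCommGroup E]
    [InnerProductSpace ℝ E] {N : Finset ι} {u : ι → E} {w : E} {a L : ℝ} (hL : 0 < L)
    (hN : N.Nonempty) (hu : ∀ i ∈ N, ‖u i‖ ^ 2 ≤ a) (haL : a ≤ L) (hw : ‖w‖ ^ 2 ≤ L)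
    (hin : ∀ i ∈ N, 1 / 2 ≤ inner ℝ (u i) w) :
    ∃ S ⊆ N, (N.card : ℝ) ≤ 8 * L ^ 2 * S.card ∧
      ∀ i ∈ S, ‖u i - (N.card : ℝ)⁻¹ • ∑ k ∈ N, u k‖ ^ 2 ≤ a - 1 / (8 * L) := by
  classical
  set c : E := (N.card : ℝ)⁻¹ • ∑ k ∈ N, u k with hc
  have hn : (0 : ℝ) < N.card := by exact_mod_cast hN.card_pos
  have hcw : 1 / 2 ≤ inner ℝ c w := by
    rw [hc, inner_mean]
    have : ∑ k ∈ N, (1 / 2 : ℝ) ≤ ∑ k ∈ N, inner ℝ (u k) w := Finset.sum_le_sum hin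
    rw [Finset.sum_const, nsmul_eq_mul] at this
    rw [le_inv_mul_iff₀ hn]
    exact this
  have hcc : 1 / (4 * L) ≤ ‖c‖ ^ 2 := by
    have h1 : inner ℝ c w ≤ ‖c‖ * ‖w‖ := real_inner_le_norm c w
    have h2 : (1 / 2 : ℝ) ^ 2 ≤ (‖c‖ * ‖w‖) ^ 2 := by
      apply pow_le_pow_left₀ (by norm_num) (hcw.trans h1)
    rw [mul_pow] at h2
    rw [div_le_iff₀ (by positivity)]
    nlinarith [mul_le_mul_of_nonneg_left hw (sq_nonneg ‖c‖)]
  have hdec : ∀ i, ‖u i - c‖ ^ 2 = ‖u i‖ ^ 2 - (2 * inner ℝ (u i) c - ‖c‖ ^ 2) := by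
    intro i
    rw [norm_sub_sq_real]; ring
  have hsum : ∑ i ∈ N, (2 * inner ℝ (u i) c - ‖c‖ ^ 2) = N.card * ‖c‖ ^ 2 := by
    have h1 : inner ℝ c c = (N.card : ℝ)⁻¹ * ∑ k ∈ N, inner ℝ (u k) c := by
      conv_lhs => rw [hc]
      rw [← hc, inner_mean]
    rw [real_inner_self_eq_norm_sq] at h1
    have h2 : ∑ k ∈ N, inner ℝ (u k) c = N.card * ‖c‖ ^ 2 := by
      rw [h1]; field_simp
    rw [Finset.sum_sub_distrib, ← Finset.mul_sum, h2, Finset.sum_const, nsmul_eq_mul]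
    ring
  -- The decrease of the squared norm averages to ‖c‖² ≥ 1/(4L) over `N` and never exceeds `L`, so a
  -- proportion 1/(8L²) of the indices gains at least 1/(8L).
  refine ⟨N.filter fun i => 1 / (8 * L) ≤ 2 * inner ℝ (u i) c - ‖c‖ ^ 2,
    Finset.filter_subset _ _, ?_, ?_⟩
  · have h1 : ∑ i ∈ N, (2 * inner ℝ (u i) c - ‖c‖ ^ 2) ≤
        ∑ i ∈ N, ((if 1 / (8 * L) ≤ 2 * inner ℝ (u i) c - ‖c‖ ^ 2 then L else 0) +
          1 / (8 * L)) := by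
      refine Finset.sum_le_sum fun i hi => ?_
      have := hdec i
      have h3 := hu i hi
      have h4 := sq_nonneg ‖u i - c‖
      have h5 : 0 < 1 / (8 * L) := by positivity
      split_ifs with h
      · linarith
      · linarith
    rw [hsum, Finset.sum_add_distrib, ← Finset.sum_filter, Finset.sum_const, Finset.sum_const,
      nsmul_eq_mul, nsmul_eq_mul] at h1
    set s : ℝ := ((N.filter fun i => 1 / (8 * L) ≤ 2 * inner ℝ (u i) c - ‖c‖ ^ 2).card : ℝ)
    have h2 : (N.card : ℝ) * (1 / (4 * L)) ≤ N.card * ‖c‖ ^ 2 := by gcongr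
    have h3 : (N.card : ℝ) * (1 / (8 * L)) ≤ s * L := by
      have : (1 : ℝ) / (4 * L) = 2 * (1 / (8 * L)) := by field_simp; norm_num
      rw [this] at h2
      linarith
    rw [mul_one_div, div_le_iff₀ (by positivity)] at h3
    linarith
  · intro i hi
    rw [Finset.mem_filter] at hi
    rw [hdec i]
    linarith [hu i hi.1, hi.2]

/-! ### Making all rows almost constant -/

/-- A family of vectors whose inner products with each test vector are `0` or `1` contains a
large subfamily on which each of these inner products is almost constant. -/
theorem exists_subset_almost_constant {ι κ E : Type*} [NormedAddCommGroup E]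
    [InnerProductSpace ℝ E] (R : ι → κ → Prop) [∀ i j, Decidable (R i j)] (S : Finset ι)
    (u : ι → E) (v : κ → E) {L : ℝ} (hL : 0 < L) {Y : ℕ} (hY : 0 < Y) (hu : ∀ i ∈ S, ‖u i‖ ^ 2 ≤ L) (p : ℕ) :
    ∀ (T : Finset κ) (c : E) (r : ℝ), T.Nonempty →
      (∀ i ∈ S, ∀ j ∈ T, inner ℝ (u i) (v j) = if R i j then (1 : ℝ) else 0) →
      (∀ j ∈ T, ‖v j - c‖ ^ 2 ≤ r) → 4 * L * r ≤ p →
      ∃ T₀ ⊆ T, T₀.Nonempty ∧ T.card ≤ Y ^ p * T₀.card ∧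
        ∀ i ∈ S, Y * (T₀.filter fun j => R i j).card ≤ T₀.card ∨
          Y * (T₀.filter fun j => ¬ R i j).card ≤ T₀.card := by
  have key : ∀ (T : Finset κ) (c : E) (r : ℝ), (∀ j ∈ T, ‖v j - c‖ ^ 2 ≤ r) → ∀ x : E,
      ‖x‖ ^ 2 ≤ L → (∀ j ∈ T, 1 / 2 ≤ inner ℝ x (v j - c)) → T.Nonempty →
      ∃ c' : E, (∀ j ∈ T, ‖v j - c'‖ ^ 2 ≤ r - 1 / (4 * L)) := by
    intro T c r hr x hx hT hne
    have hx0 : 0 < ‖x‖ ^ 2 := by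
      rcases hne with ⟨j, hj⟩
      have : x ≠ 0 := by
        rintro rfl
        have := hT j hj
        rw [inner_zero_left] at this
        norm_num at this
      positivity
    -- The step length t = 1/(2‖x‖²) minimizes -t + t²‖x‖², with minimum -1/(4‖x‖²).
    refine ⟨c + (1 / (2 * ‖x‖ ^ 2)) • x, fun j hj => ?_⟩
    rw [← sub_sub, norm_sub_sq_real, inner_smul_right, norm_smul, mul_pow, real_inner_comm]
    have h1 := hr j hj
    have h2 := hT j hj
    have h3 : 1 / (4 * L) ≤ 1 / (4 * ‖x‖ ^ 2) := by gcongr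
    have h4 : ‖(1 / (2 * ‖x‖ ^ 2) : ℝ)‖ ^ 2 * ‖x‖ ^ 2 = 1 / (4 * ‖x‖ ^ 2) := by
      rw [Real.norm_eq_abs, sq_abs]; field_simp; norm_num
    have h5 : 1 / (2 * ‖x‖ ^ 2) * (1 / 2) ≤ 1 / (2 * ‖x‖ ^ 2) * inner ℝ x (v j - c) := by
      gcongr
    have h6 : 1 / (2 * ‖x‖ ^ 2) * (1 / 2) = 1 / (4 * ‖x‖ ^ 2) := by
      field_simp; norm_num
    rw [h4]
    linarith
  have step : ∀ (T : Finset κ) (c : E) (r : ℝ),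
      (∀ i ∈ S, ∀ j ∈ T, inner ℝ (u i) (v j) = if R i j then (1 : ℝ) else 0) →
      (∀ j ∈ T, ‖v j - c‖ ^ 2 ≤ r) → ∀ i ∈ S,
      T.card < Y * (T.filter fun j => R i j).card →
      T.card < Y * (T.filter fun j => ¬ R i j).card →
      ∃ T' ⊆ T, T.card ≤ Y * T'.card ∧ T'.Nonempty ∧
        ∃ c' : E, (∀ j ∈ T', ‖v j - c'‖ ^ 2 ≤ r - 1 / (4 * L)) := by
    intro T c r hR hr i hi h1 h2
    have ne1 : (T.filter fun j => R i j).Nonempty := by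
      rw [← Finset.card_pos]; by_contra h; simp only [not_lt, Nat.le_zero] at h; simp [h] at h1
    have ne2 : (T.filter fun j => ¬ R i j).Nonempty := by
      rw [← Finset.card_pos]; by_contra h; simp only [not_lt, Nat.le_zero] at h; simp [h] at h2
    -- The inner products with `u i` are 0 or 1, so wherever the centre lies relative to 1/2, one of
    -- the two parts is separated from it by at least 1/2. Both parts are large, so that part may be
    -- kept.
    rcases le_total (inner ℝ (u i) c) (1 / 2) with hc | hc
    · refine ⟨_, Finset.filter_subset (fun j => R i j) T, h1.le, ne1, ?_⟩
      refine key _ c r (fun j hj => hr j (Finset.mem_of_mem_filter j hj)) (u i) (hu i hi) ?_ ne1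
      intro j hj
      rw [Finset.mem_filter] at hj
      rw [inner_sub_right, hR i hi j hj.1, if_pos hj.2]
      linarith
    · refine ⟨_, Finset.filter_subset (fun j => ¬ R i j) T, h2.le, ne2, ?_⟩
      refine key _ c r (fun j hj => hr j (Finset.mem_of_mem_filter j hj)) (-u i)
        (by rw [norm_neg]; exact hu i hi) ?_ ne2
      intro j hj
      rw [Finset.mem_filter] at hj
      rw [inner_neg_left, inner_sub_right, hR i hi j hj.1, if_neg hj.2]
      linarith
  induction p with
  | zero =>
    intro T c r hT hR hr hp
    refine ⟨T, subset_rfl, hT, by simp, fun i hi => ?_⟩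
    by_contra! h
    obtain ⟨T', hsub, -, ⟨j, hj⟩, c', hc'⟩ := step T c r hR hr i hi h.1 h.2
    have h1 := hc' j hj
    have h2 : r ≤ 0 := by
      by_contra! h0
      have : 0 < 4 * L * r := by positivity
      simp at hp; linarith
    have h3 : 0 < 1 / (4 * L) := by positivity
    linarith [sq_nonneg ‖v j - c'‖]
  | succ p ih =>
    intro T c r hT hR hr hp
    by_cases hgood : ∀ i ∈ S, Y * (T.filter fun j => R i j).card ≤ T.card ∨
        Y * (T.filter fun j => ¬ R i j).card ≤ T.card
    · exact ⟨T, subset_rfl, hT, Nat.le_mul_of_pos_left _ (by positivity), hgood⟩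
    · push Not at hgood
      obtain ⟨i, hi, h1, h2⟩ := hgood
      obtain ⟨T', hsub, hcard, hne, c', hc'⟩ := step T c r hR hr i hi h1 h2
      obtain ⟨T₀, hT₀, hne₀, hcard₀, hconst⟩ := ih T' c' _ hne
        (fun i hi j hj => hR i hi j (hsub hj)) hc' (by
          have : 4 * L * (r - 1 / (4 * L)) = 4 * L * r - 1 := by field_simp
          rw [this]; push_cast at hp; linarith)
      refine ⟨T₀, hT₀.trans hsub, hne₀, ?_, hconst⟩
      calc T.card ≤ Y * T'.card := hcard
        _ ≤ Y * (Y ^ p * T₀.card) := by gcongr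
        _ = Y ^ (p + 1) * T₀.card := by ring

/-! ### Rectangles with dense columns -/

theorem sum_card_filter_comm {ι κ : Type*} (S : Finset ι) (T : Finset κ) (R : ι → κ → Prop)
    [∀ i j, Decidable (R i j)] :
    ∑ i ∈ S, (T.filter fun j => R i j).card = ∑ j ∈ T, (S.filter fun i => R i j).card := by
  simp only [Finset.card_filter]
  exact Finset.sum_comm

open Classical in
/-- If the vectors of a family `N` all correlate with a test vector, then one of them can be shifted
to have smaller norm, while its inner products with the test vectors change little outside of a
small set. -/
theorem exists_shift_off_small_set {ι κ E : Type*} [NormedAddCommGroup E]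
    [InnerProductSpace ℝ E] (R : ι → κ → Prop) (T : Finset κ) (v : κ → E) (N : Finset ι) (u : ι → E)
    (X : ι → Finset κ) {L m V a η z B : ℝ} (hL : 0 < L) (hm : 0 ≤ m) (hη0 : 0 < η)
    (hηle : η ≤ 1 / 4) (hηinv : 1 ≤ η * B) (hV : 2 + L * B ≤ V) (p : ℕ)
    (hNne : N.Nonempty) (haL : a ≤ L) (hv : ∀ l ∈ T, ‖v l‖ ^ 2 ≤ L) (hu : ∀ i ∈ N, ‖u i‖ ^ 2 ≤ a)
    (herr : ∀ i ∈ N, ∀ l ∈ T, l ∉ X i → |inner ℝ (u i) (v l) - if R i l then 1 else 0| ≤ η)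
    (hX : ∀ i ∈ N, (X i).card * m * V ^ (p + 1) ≤ z)
    (hcorr : ∃ l ∈ T, ∀ i ∈ N, l ∉ X i ∧ R i l)
    (hsmall : (T.filter fun l => η * N.card < (N.filter fun i => R i l).card).card * m *
      V ^ (p + 1) ≤ z) :
    ∃ i ∈ N, ∃ (w : E) (X' : Finset κ), ‖w‖ ^ 2 ≤ a - 1 / (8 * L) ∧ X'.card * m * V ^ p ≤ z ∧
      ∀ l ∈ T, l ∉ X' → |inner ℝ w (v l) - if R i l then 1 else 0| ≤ 4 * η := by
  have hB : 0 < B := by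
    by_contra! h
    nlinarith
  have hV0 : 0 < V := by
    have : 0 < L * B := by positivity
    linarith
  have hNpos : 0 < (N.card : ℝ) := by exact_mod_cast hNne.card_pos
  have hz : 0 ≤ z := le_trans (by positivity) hsmall
  obtain ⟨l₀, hl₀, hl₀N⟩ := hcorr
  obtain ⟨S', hS'N, hcard, hS'⟩ := exists_subset_norm_sub_mean_le (u := u) (w := v l₀) hL hNne
    hu haL (hv l₀ hl₀) (by
      intro i hi
      have := herr i hi l₀ hl₀ (hl₀N i hi).1
      rw [if_pos (hl₀N i hi).2] at this
      have := (abs_le.mp this).1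
      linarith)
  set c : E := (N.card : ℝ)⁻¹ • ∑ k ∈ N, u k with hc
  have hS'ne : S'.Nonempty := by
    rw [← Finset.card_pos]
    by_contra! h
    have h0 : S'.card = 0 := by omega
    rw [h0] at hcard
    simp only [Nat.cast_zero, mul_zero] at hcard
    linarith
  obtain ⟨i, hi⟩ := hS'ne
  have hiN := hS'N hi
  -- Off these sets the mean has inner product at most 3η with `v l`: one η each from the
  -- approximation error, from related rows (`T₁`) and from rows with `l ∈ X k` (`T₂`). In the last
  -- case only Cauchy–Schwarz is available, hence the weight `L`.
  set T₁ := T.filter fun l => η * N.card < (N.filter fun i => R i l).card with hT₁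
  set T₂ := T.filter fun l => η * N.card < L * (N.filter fun i => l ∈ X i).card with hT₂
  refine ⟨i, hiN, u i - c, X i ∪ T₁ ∪ T₂, hS' i hi, ?_, ?_⟩
  · have h2 : (T₂.card : ℝ) * (η * N.card) ≤ L * ∑ i ∈ N, ((X i).card : ℝ) := by
      calc (T₂.card : ℝ) * (η * N.card) = ∑ l ∈ T₂, η * N.card := by
            rw [Finset.sum_const, nsmul_eq_mul]
        _ ≤ ∑ l ∈ T₂, L * ((N.filter fun i => l ∈ X i).card : ℝ) := by
            refine Finset.sum_le_sum fun l hl => ?_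
            exact (Finset.mem_filter.mp hl).2.le
        _ = L * ((∑ l ∈ T₂, (N.filter fun i => l ∈ X i).card : ℕ) : ℝ) := by
            rw [← Finset.mul_sum]; push_cast; rfl
        _ = L * ((∑ i ∈ N, (T₂.filter fun l => l ∈ X i).card : ℕ) : ℝ) := by
            rw [← sum_card_filter_comm N T₂ fun i l => l ∈ X i]
        _ ≤ L * ∑ i ∈ N, ((X i).card : ℝ) := by
            push_cast
            gcongr with i hi
            intro l hl
            exact (Finset.mem_filter.mp hl).2
    have h2' : (T₂.card : ℝ) * m * V ^ (p + 1) ≤ L * B * z := by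
      have h3 : (∑ i ∈ N, ((X i).card : ℝ)) * (m * V ^ (p + 1)) ≤ N.card * z := by
        rw [Finset.sum_mul, ← nsmul_eq_mul, ← Finset.sum_const]
        refine Finset.sum_le_sum fun i hi => ?_
        rw [← mul_assoc]
        exact hX i hi
      have h4 : (T₂.card : ℝ) * m * V ^ (p + 1) * η * N.card ≤ L * z * N.card := by
        calc (T₂.card : ℝ) * m * V ^ (p + 1) * η * N.card
            = (T₂.card * (η * N.card)) * (m * V ^ (p + 1)) := by ring
          _ ≤ (L * ∑ i ∈ N, ((X i).card : ℝ)) * (m * V ^ (p + 1)) := by gcongr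
          _ = L * ((∑ i ∈ N, ((X i).card : ℝ)) * (m * V ^ (p + 1))) := by ring
          _ ≤ L * (N.card * z) := by gcongr
          _ = _ := by ring
      have h5 := le_of_mul_le_mul_right h4 hNpos
      calc (T₂.card : ℝ) * m * V ^ (p + 1)
          ≤ (T₂.card : ℝ) * m * V ^ (p + 1) * (η * B) :=
            le_mul_of_one_le_right (by positivity) hηinv
        _ = ((T₂.card : ℝ) * m * V ^ (p + 1) * η) * B := by ring
        _ ≤ L * z * B := by gcongr
        _ = _ := by ring
    have h3 := hX i hiN
    have h4 : ((X i ∪ T₁ ∪ T₂).card : ℝ) ≤ (X i).card + T₁.card + T₂.card := by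
      exact_mod_cast (Finset.card_union_le _ _).trans
        (Nat.add_le_add_right (Finset.card_union_le _ _) _)
    -- The three sets contribute z, z and L·B·z; this is the source of `2 + L * B ≤ V`.
    have h5 : ((X i ∪ T₁ ∪ T₂).card : ℝ) * m * V ^ p * V ≤ z * V := by
      calc ((X i ∪ T₁ ∪ T₂).card : ℝ) * m * V ^ p * V
          = ((X i ∪ T₁ ∪ T₂).card : ℝ) * (m * V ^ (p + 1)) := by ring
        _ ≤ ((X i).card + T₁.card + T₂.card : ℝ) * (m * V ^ (p + 1)) := by gcongr
        _ = (X i).card * m * V ^ (p + 1) + T₁.card * m * V ^ (p + 1) +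
            T₂.card * m * V ^ (p + 1) := by ring
        _ ≤ z + z + L * B * z := by gcongr
        _ = z * (2 + L * B) := by ring
        _ ≤ z * V := by gcongr
    exact le_of_mul_le_mul_right h5 hV0
  · intro l hl hlX
    simp only [Finset.mem_union, not_or] at hlX
    obtain ⟨⟨hlXi, hlT₁⟩, hlT₂⟩ := hlX
    have h1 : ((N.filter fun i => R i l).card : ℝ) ≤ η * N.card := by
      by_contra! h
      exact hlT₁ (Finset.mem_filter.mpr ⟨hl, h⟩)
    have h2 : L * ((N.filter fun i => l ∈ X i).card : ℝ) ≤ η * N.card := by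
      by_contra! h
      exact hlT₂ (Finset.mem_filter.mpr ⟨hl, h⟩)
    have h3 : |∑ k ∈ N, inner ℝ (u k) (v l)| ≤ 3 * η * N.card := by
      calc |∑ k ∈ N, inner ℝ (u k) (v l)| ≤ ∑ k ∈ N, |inner ℝ (u k) (v l)| :=
            Finset.abs_sum_le_sum_abs _ _
        _ ≤ ∑ k ∈ N, (η + (if R k l then 1 else 0) + L * (if l ∈ X k then 1 else 0)) := by
            refine Finset.sum_le_sum fun k hk => ?_
            by_cases hlk : l ∈ X k
            · rw [if_pos hlk]
              have h4 : |inner ℝ (u k) (v l)| ≤ L := by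
                refine (abs_real_inner_le_norm _ _).trans ?_
                have h5 := (hu k hk).trans haL
                have h6 := hv l hl
                nlinarith [sq_nonneg (‖u k‖ - ‖v l‖)]
              have : (0 : ℝ) ≤ if R k l then 1 else 0 := by split_ifs <;> norm_num
              linarith
            · rw [if_neg hlk]
              have h4 := abs_le.mp (herr k hk l hl hlk)
              rw [abs_le]
              split_ifs at h4 ⊢ <;> constructor <;> linarith [h4.1, h4.2]
        _ = η * N.card + (N.filter fun i => R i l).card +
            L * ((N.filter fun i => l ∈ X i).card : ℝ) := by
            rw [Finset.sum_add_distrib, Finset.sum_add_distrib, ← Finset.mul_sum,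
              Finset.sum_const, nsmul_eq_mul, Finset.card_filter, Finset.card_filter]
            push_cast
            ring
        _ ≤ 3 * η * N.card := by linarith
    have h4 : |inner ℝ c (v l)| ≤ 3 * η := by
      rw [hc, inner_mean, abs_mul, abs_inv, Nat.abs_cast, inv_mul_le_iff₀ hNpos]
      linarith
    have h5 := herr i hiN l hl hlXi
    rw [inner_sub_left]
    calc |inner ℝ (u i) (v l) - inner ℝ c (v l) - if R i l then 1 else 0|
        = |(inner ℝ (u i) (v l) - if R i l then 1 else 0) - inner ℝ c (v l)| := by
          congr 1; ring
      _ ≤ |inner ℝ (u i) (v l) - if R i l then 1 else 0| + |inner ℝ c (v l)| := abs_sub _ _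
      _ ≤ 4 * η := by linarith

open Classical in
/-- A relation that is approximated by inner products outside of small exceptional sets and that
has no dense rectangle of prescribed size has few related pairs outside of the exceptional sets. -/
theorem sum_card_le_of_no_dense_rectangle {ι κ E : Type*} [NormedAddCommGroup E]
    [InnerProductSpace ℝ E] (R : ι → κ → Prop) (S₀ : Finset ι) (T : Finset κ) (v : κ → E)
    {L m n F k z z' V : ℝ} (P : ℕ) (hL : 0 < L) (hm : 0 < m) (hn : 0 < n) (hF : 0 ≤ F)
    (hk : 0 ≤ k) (hz' : 0 ≤ z') (hV : 2 + L * 4 ^ (P + 1) ≤ V) (hz : z * V ^ (P + 1) ≤ z')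
    (hS₀ : S₀.card ≤ m) (hT : T.card ≤ n) (hv : ∀ l ∈ T, ‖v l‖ ^ 2 ≤ L)
    (hno : ∀ N ⊆ S₀, ∀ T' ⊆ T, N.Nonempty → k * F ≤ N.card * n →
      (∀ l ∈ T', (1 / 4 : ℝ) ^ (P + 1) * N.card < (N.filter fun i => R i l).card) →
      T'.card * m ≤ z * F) (p : ℕ) (hp : p ≤ P) :
    ∀ (S : Finset ι) (u : ι → E) (X : ι → Finset κ) (a : ℝ), S ⊆ S₀ → a ≤ L → 8 * L * a ≤ p →
      (∀ i ∈ S, ‖u i‖ ^ 2 ≤ a) →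
      (∀ i ∈ S, ∀ l ∈ T, l ∉ X i →
        |inner ℝ (u i) (v l) - if R i l then 1 else 0| ≤ (1 / 4 : ℝ) ^ (p + 1)) →
      (∀ i ∈ S, (X i).card * m * V ^ p ≤ z' * F) →
      ((∑ i ∈ S, (T.filter fun l => l ∉ X i ∧ R i l).card : ℕ) : ℝ) ≤ p * (k + z') * F := by
  have hV1 : 1 ≤ V := by
    have : 0 < L * 4 ^ (P + 1) := by positivity
    linarith
  have hV0 : 0 < V := by linarith
  induction p with
  | zero =>
    intro S u X a hS haL ha hu herr hX
    have ha0 : a ≤ 0 := by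
      by_contra! h
      have : 0 < 8 * L * a := by positivity
      simp at ha; linarith
    -- With no energy left the vectors vanish, and an error of at most 1/4 rules out related pairs.
    have : ∑ i ∈ S, (T.filter fun l => l ∉ X i ∧ R i l).card = 0 := by
      refine Finset.sum_eq_zero fun i hi => ?_
      rw [Finset.card_eq_zero, Finset.filter_eq_empty_iff]
      rintro l hl ⟨hlX, hR⟩
      have h1 := herr i hi l hl hlX
      have h2 : u i = 0 := by
        have := hu i hi
        have h3 : ‖u i‖ ^ 2 = 0 := le_antisymm (by linarith) (sq_nonneg _)
        simpa using h3
      rw [h2, inner_zero_left, if_pos hR] at h1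
      norm_num at h1
    rw [this]; simp
  | succ p ih =>
    intro S u X a hS haL ha hu herr hX
    set η : ℝ := (1 / 4 : ℝ) ^ (p + 1 + 1) with hη
    have hη0 : 0 < η := by positivity
    have hη4 : 4 * η = (1 / 4 : ℝ) ^ (p + 1) := by rw [hη, pow_succ _ (p + 1)]; ring
    have hηle : η ≤ 1 / 4 := by
      rw [hη, pow_succ]
      have : (1 / 4 : ℝ) ^ (p + 1) ≤ 1 := pow_le_one₀ (by norm_num) (by norm_num)
      linarith
    have hηP : (1 / 4 : ℝ) ^ (P + 1) ≤ η :=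
      pow_le_pow_of_le_one (by norm_num) (by norm_num) (by omega)
    have hηinv : 1 ≤ η * 4 ^ (P + 1) := by
      calc (1 : ℝ) = (1 / 4 : ℝ) ^ (P + 1) * 4 ^ (P + 1) := by rw [← mul_pow]; norm_num
        _ ≤ η * 4 ^ (P + 1) := by gcongr
    have hzF : 0 ≤ z' * F := by positivity
    let G : ι → E → Finset κ → Prop := fun i w X' =>
      ‖w‖ ^ 2 ≤ a - 1 / (8 * L) ∧ X'.card * m * V ^ p ≤ z' * F ∧
        ∀ l ∈ T, l ∉ X' → |inner ℝ w (v l) - if R i l then 1 else 0| ≤ (1 / 4 : ℝ) ^ (p + 1)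
    -- If more than kF/n rows without a replacement met one column, they would form a family `N` to
    -- which the mean shift applies, and one of them would have a replacement after all.
    have hrem : ∀ l ∈ T, ((S.filter fun i => (¬ ∃ w X', G i w X') ∧ l ∉ X i ∧ R i l).card : ℝ) * n
        ≤ k * F := by
      intro l₀ hl₀
      by_contra hbig
      rw [not_le] at hbig
      obtain ⟨N, hN⟩ : ∃ N, N = S.filter fun i => (¬ ∃ w X', G i w X') ∧ l₀ ∉ X i ∧ R i l₀ :=
        ⟨_, rfl⟩
      rw [← hN] at hbig
      have hNS : ∀ i ∈ N, i ∈ S := fun i hi => by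
        rw [hN] at hi; exact Finset.mem_of_mem_filter i hi
      have hNne : N.Nonempty := by
        rw [Finset.nonempty_iff_ne_empty]
        rintro rfl
        have : 0 ≤ k * F := by positivity
        simp only [Finset.card_empty, Nat.cast_zero, zero_mul] at hbig
        linarith
      have hsmall : ((T.filter fun l => η * N.card < (N.filter fun i => R i l).card).card : ℝ) *
          m * V ^ (p + 1) ≤ z' * F := by
        have h1 := hno N (fun x hx => hS (hNS x hx))
          (T.filter fun l => η * N.card < (N.filter fun i => R i l).card)
          (Finset.filter_subset _ _) hNne hbig.le (fun l hl =>
            lt_of_le_of_lt (by gcongr) (Finset.mem_filter.mp hl).2)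
        have hz0 : 0 ≤ z * F := le_trans (by positivity) h1
        calc _ ≤ (z * F) * V ^ (p + 1) := by gcongr
          _ ≤ (z * F) * V ^ (P + 1) :=
            mul_le_mul_of_nonneg_left (pow_le_pow_right₀ hV1 (by omega)) hz0
          _ = (z * V ^ (P + 1)) * F := by ring
          _ ≤ z' * F := by gcongr
      obtain ⟨i, hi, w, X', h⟩ := exists_shift_off_small_set R T v N u X hL hm.le hη0 hηle hηinv hV
        p hNne haL hv (fun i hi => hu i (hNS i hi)) (fun i hi => herr i (hNS i hi))
        (fun i hi => hX i (hNS i hi))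
        ⟨l₀, hl₀, fun i hi => by rw [hN] at hi; exact (Finset.mem_filter.mp hi).2.2⟩ hsmall
      rw [hN] at hi
      rw [hη4] at h
      exact (Finset.mem_filter.mp hi).2.1 ⟨w, X', h⟩
    have hchoice : ∀ i, ∃ w X', (∃ w X', G i w X') → G i w X' := by
      intro i
      by_cases h : ∃ w X', G i w X'
      · obtain ⟨w, X', h'⟩ := h
        exact ⟨w, X', fun _ => h'⟩
      · exact ⟨0, ∅, fun h' => absurd h' h⟩
    choose w X' hG using hchoice
    set D := S.filter fun i => ∃ w X', G i w X' with hD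
    have hGD : ∀ i ∈ D, G i (w i) (X' i) := fun i hi => hG i (Finset.mem_filter.mp hi).2
    have hih := ih (by omega) D w X' (a - 1 / (8 * L)) ((Finset.filter_subset _ _).trans hS)
      (by have : 0 < 1 / (8 * L) := by positivity
          linarith)
      (by have : 8 * L * (a - 1 / (8 * L)) = 8 * L * a - 1 := by field_simp
          rw [this]; push_cast at ha; linarith)
      (fun i hi => (hGD i hi).1) (fun i hi => (hGD i hi).2.2) (fun i hi => (hGD i hi).2.1)
    -- Trading `X` for `X'` loses at most the pairs inside `X'`, which is the `z'` share of this
    -- level's loss.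
    have hX' : ((∑ i ∈ D, (X' i).card : ℕ) : ℝ) ≤ z' * F := by
      have h1 : ∀ i ∈ D, ((X' i).card : ℝ) ≤ z' * F / m := by
        intro i hi
        rw [le_div_iff₀ hm]
        refine le_trans ?_ (hGD i hi).2.1
        exact le_mul_of_one_le_right (by positivity) (one_le_pow₀ hV1)
      push_cast
      calc ∑ i ∈ D, ((X' i).card : ℝ) ≤ ∑ i ∈ D, z' * F / m := Finset.sum_le_sum h1
        _ = D.card * (z' * F / m) := by rw [Finset.sum_const, nsmul_eq_mul]
        _ ≤ m * (z' * F / m) := by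
          gcongr
          refine le_trans ?_ hS₀
          exact_mod_cast Finset.card_le_card ((Finset.filter_subset _ _).trans hS)
        _ = z' * F := by field_simp
    have hDsum : ∑ i ∈ D, (T.filter fun l => l ∉ X i ∧ R i l).card ≤
        ∑ i ∈ D, (T.filter fun l => l ∉ X' i ∧ R i l).card + ∑ i ∈ D, (X' i).card := by
      rw [← Finset.sum_add_distrib]
      refine Finset.sum_le_sum fun i _ => ?_
      refine (Finset.card_le_card ?_).trans (Finset.card_union_le _ _)
      intro l hl
      simp only [Finset.mem_filter, Finset.mem_union] at hl ⊢
      tauto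
    have hremsum : ((∑ i ∈ S.filter fun i => ¬ ∃ w X', G i w X',
        (T.filter fun l => l ∉ X i ∧ R i l).card : ℕ) : ℝ) ≤ k * F := by
      rw [sum_card_filter_comm _ T fun i l => l ∉ X i ∧ R i l]
      push_cast
      calc ∑ l ∈ T, (((S.filter fun i => ¬ ∃ w X', G i w X').filter
              fun i => l ∉ X i ∧ R i l).card : ℝ)
          ≤ ∑ l ∈ T, k * F / n := by
            refine Finset.sum_le_sum fun l hl => ?_
            rw [le_div_iff₀ hn, Finset.filter_filter]
            exact hrem l hl
        _ = T.card * (k * F / n) := by rw [Finset.sum_const, nsmul_eq_mul]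
        _ ≤ n * (k * F / n) := by gcongr
        _ = k * F := by field_simp
    rw [← Finset.sum_filter_add_sum_filter_not S (fun i => ∃ w X', G i w X')]
    have hDsum' : ((∑ i ∈ D, (T.filter fun l => l ∉ X i ∧ R i l).card : ℕ) : ℝ) ≤
        ((∑ i ∈ D, (T.filter fun l => l ∉ X' i ∧ R i l).card : ℕ) : ℝ) +
          ((∑ i ∈ D, (X' i).card : ℕ) : ℝ) := by exact_mod_cast hDsum
    rw [Nat.cast_add]
    push_cast at *
    linarith

open Classical in
/-- A nonempty relation given by inner products of bounded vectors contains a rectangle, of size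
proportional to the average degrees, in which all columns are dense. -/
theorem exists_dense_rectangle {ι κ E : Type*} [NormedAddCommGroup E]
    [InnerProductSpace ℝ E] (R : ι → κ → Prop) (S : Finset ι) (T : Finset κ) (u : ι → E)
    (v : κ → E) {L V : ℝ} (P : ℕ) (hL : 0 < L) (hP : 8 * L * L ≤ P)
    (hV : 2 + L * 4 ^ (P + 1) ≤ V) (hu : ∀ i ∈ S, ‖u i‖ ^ 2 ≤ L) (hv : ∀ l ∈ T, ‖v l‖ ^ 2 ≤ L)
    (huv : ∀ i ∈ S, ∀ l ∈ T, inner ℝ (u i) (v l) = if R i l then (1 : ℝ) else 0)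
    (hpos : 0 < ∑ i ∈ S, (T.filter fun l => R i l).card) :
    ∃ N ⊆ S, ∃ T' ⊆ T, N.Nonempty ∧
      ((∑ i ∈ S, (T.filter fun l => R i l).card : ℕ) : ℝ) ≤ 4 * (P + 1) * (N.card * T.card) ∧
      ((∑ i ∈ S, (T.filter fun l => R i l).card : ℕ) : ℝ) ≤
        4 * (P + 1) * V ^ (P + 1) * (T'.card * S.card) ∧
      ∀ l ∈ T', (1 / 4 : ℝ) ^ (P + 1) * N.card < (N.filter fun i => R i l).card := by
  obtain ⟨F, hF⟩ : ∃ F, F = ∑ i ∈ S, (T.filter fun l => R i l).card := ⟨_, rfl⟩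
  rw [← hF] at hpos ⊢
  have hFpos : (0 : ℝ) < F := by exact_mod_cast hpos
  have hSne : S.Nonempty := by
    by_contra h; rw [Finset.not_nonempty_iff_eq_empty] at h; simp [hF, h] at hpos
  have hTne : T.Nonempty := by
    by_contra h; rw [Finset.not_nonempty_iff_eq_empty] at h; simp [hF, h] at hpos
  have hV0 : 0 < V := by
    have : 0 < L * 4 ^ (P + 1) := by positivity
    linarith
  have hden : (0 : ℝ) < 4 * (P + 1) := by positivity
  have hdenV : (0 : ℝ) < 4 * (P + 1) * V ^ (P + 1) := by positivity
  by_contra hcon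
  have hno : ∀ N ⊆ S, ∀ T' ⊆ T, N.Nonempty → (4 * (P + 1) : ℝ)⁻¹ * F ≤ N.card * T.card →
      (∀ l ∈ T', (1 / 4 : ℝ) ^ (P + 1) * N.card < (N.filter fun i => R i l).card) →
      T'.card * (S.card : ℝ) ≤ (4 * (P + 1) * V ^ (P + 1))⁻¹ * F := by
    intro N hN T' hT' hNne hNF hdense
    by_contra hlt
    rw [not_le] at hlt
    refine hcon ⟨N, hN, T', hT', hNne, ?_, ?_, hdense⟩
    · exact (inv_mul_le_iff₀ hden).mp hNF
    · exact (inv_mul_le_iff₀ hdenV).mp hlt.le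
  have hz : (4 * (P + 1) * V ^ (P + 1) : ℝ)⁻¹ * V ^ (P + 1) ≤ (4 * (P + 1) : ℝ)⁻¹ := by
    rw [mul_inv, mul_assoc, inv_mul_cancel₀ (by positivity), mul_one]
  -- With `k` and `z'` both equal to 1/(4(P+1)), the `P` levels account for less than half of the
  -- `F` related pairs.
  have key := sum_card_le_of_no_dense_rectangle R S T v P hL
    (by exact_mod_cast hSne.card_pos) (by exact_mod_cast hTne.card_pos) hFpos.le
    (inv_nonneg.mpr hden.le) (inv_nonneg.mpr hden.le) hV hz le_rfl le_rfl hv hno P le_rfl S u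
    (fun _ => ∅) L subset_rfl le_rfl hP hu (by
      intro i hi l hl _
      rw [huv i hi l hl, sub_self, abs_zero]
      exact pow_nonneg (by norm_num) _) (by
      intro i _
      rw [Finset.card_empty, Nat.cast_zero, zero_mul, zero_mul]
      exact mul_nonneg (inv_nonneg.mpr hden.le) hFpos.le)
  have hF' : ∑ i ∈ S, (T.filter fun l => l ∉ (∅ : Finset κ) ∧ R i l).card = F := by
    rw [hF]
    refine Finset.sum_congr rfl fun i _ => ?_
    congr 1
    ext l
    simp
  rw [hF'] at key
  have h2 : (P : ℝ) * ((4 * (P + 1) : ℝ)⁻¹ + (4 * (P + 1) : ℝ)⁻¹) < 1 := by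
    rw [← two_mul, ← mul_assoc, mul_inv_lt_iff₀ hden]
    have : (0 : ℝ) ≤ P := P.cast_nonneg
    linarith
  nlinarith

/-! ### Empty rectangles in sparse relations -/

open Classical in
/-- A column `j` whose normalized degree dominates all normalized row degrees yields a set
of rows whose vectors can be shifted to smaller norm, while inner products are affected only at few columns. -/
theorem exists_cluster {ι κ E : Type*} [NormedAddCommGroup E] [InnerProductSpace ℝ E]
    (R : ι → κ → Prop) (S : Finset ι) (T : Finset κ) (u : ι → E) (v : κ → E) {L a η s t : ℝ}
    (hL : 0 < L) (hη0 : 0 < η) (hηle : η ≤ 1 / 4) (hs : 0 ≤ s) (ht : 0 ≤ t) (haL : a ≤ L)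
    (hu : ∀ i ∈ S, ‖u i‖ ^ 2 ≤ a) (hv : ∀ l ∈ T, ‖v l‖ ^ 2 ≤ L)
    (herr : ∀ i ∈ S, ∀ l ∈ T, |inner ℝ (u i) (v l) - if R i l then 1 else 0| ≤ η)
    {j : κ} (hj : j ∈ T) (hne : (S.filter fun i => R i j).Nonempty)
    (hmax : ∀ i ∈ S, (T.filter fun l => R i l).card * s ≤ (S.filter fun i => R i j).card * t) :
    ∃ P ⊆ S.filter fun i => R i j, P.Nonempty ∧ ∃ Q ⊆ T, Q.card * s ≤ 8 * L ^ 2 / η * (P.card * t) ∧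
      ∃ c : E, ∀ i ∈ P, ‖u i - c‖ ^ 2 ≤ a - 1 / (8 * L) ∧
        ∀ l ∈ T, l ∉ Q → |inner ℝ (u i - c) (v l) - if R i l then 1 else 0| ≤ 4 * η := by
  obtain ⟨N, hN⟩ : ∃ N, N = S.filter fun i => R i j := ⟨_, rfl⟩
  rw [← hN] at hne hmax ⊢
  have hNS : ∀ i ∈ N, i ∈ S ∧ R i j := fun i hi => by rwa [hN, Finset.mem_filter] at hi
  have hNpos : 0 < (N.card : ℝ) := by exact_mod_cast hne.card_pos
  obtain ⟨P, hPN, hcard, hP⟩ := exists_subset_norm_sub_mean_le (u := u) (w := v j) hL hne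
    (fun i hi => hu i (hNS i hi).1) haL (hv j hj) (by
      intro i hi
      have := herr i (hNS i hi).1 j hj
      rw [if_pos (hNS i hi).2] at this
      have := (abs_le.mp this).1
      linarith)
  set c : E := (N.card : ℝ)⁻¹ • ∑ k ∈ N, u k with hc
  have hPne : P.Nonempty := by
    rw [← Finset.card_pos]
    by_contra! h
    have h0 : P.card = 0 := by omega
    rw [h0] at hcard
    simp only [Nat.cast_zero, mul_zero] at hcard
    linarith
  obtain ⟨Q, hQ⟩ : ∃ Q, Q = T.filter fun l => η * N.card < (N.filter fun i => R i l).card :=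
    ⟨_, rfl⟩
  refine ⟨P, hPN, hPne, Q, hQ ▸ Finset.filter_subset _ _, ?_, c, fun i hi => ⟨hP i hi, ?_⟩⟩
  -- Double counting: η|Q||N| is at most the sum of the degrees of the rows in `N`, and each degree
  -- times `s` is at most |N|t by `hmax`.
  · have h1 : (Q.card : ℝ) * (η * N.card) ≤ ∑ i ∈ N, ((T.filter fun l => R i l).card : ℝ) := by
      calc (Q.card : ℝ) * (η * N.card) = ∑ l ∈ Q, η * N.card := by
            rw [Finset.sum_const, nsmul_eq_mul]
        _ ≤ ∑ l ∈ Q, ((N.filter fun i => R i l).card : ℝ) := by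
            refine Finset.sum_le_sum fun l hl => ?_
            rw [hQ] at hl
            exact (Finset.mem_filter.mp hl).2.le
        _ = ((∑ i ∈ N, (Q.filter fun l => R i l).card : ℕ) : ℝ) := by
            rw [sum_card_filter_comm N Q R]; push_cast; rfl
        _ ≤ ∑ i ∈ N, ((T.filter fun l => R i l).card : ℝ) := by
            push_cast
            refine Finset.sum_le_sum fun i _ => ?_
            exact_mod_cast Finset.card_le_card
              (Finset.filter_subset_filter _ (hQ ▸ Finset.filter_subset _ _))
    have h2 : (Q.card : ℝ) * s * η * N.card ≤ N.card * t * N.card := by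
      calc (Q.card : ℝ) * s * η * N.card = Q.card * (η * N.card) * s := by ring
        _ ≤ (∑ i ∈ N, ((T.filter fun l => R i l).card : ℝ)) * s := by gcongr
        _ ≤ ∑ i ∈ N, (N.card * t : ℝ) := by
            rw [Finset.sum_mul]
            exact Finset.sum_le_sum fun i hi => hmax i (hNS i hi).1
        _ = N.card * t * N.card := by rw [Finset.sum_const, nsmul_eq_mul]; ring
    have h3 := le_of_mul_le_mul_right h2 hNpos
    rw [div_mul_eq_mul_div, le_div_iff₀ hη0]
    calc (Q.card : ℝ) * s * η ≤ N.card * t := h3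
      _ ≤ (8 * L ^ 2 * P.card) * t := by gcongr
      _ = _ := by ring
  · intro l hl hlQ
    have h1 : ((N.filter fun i => R i l).card : ℝ) ≤ η * N.card := by
      by_contra! h
      exact hlQ (hQ ▸ Finset.mem_filter.mpr ⟨hl, h⟩)
    have h3 : |∑ k ∈ N, inner ℝ (u k) (v l)| ≤ 2 * η * N.card := by
      calc |∑ k ∈ N, inner ℝ (u k) (v l)| ≤ ∑ k ∈ N, |inner ℝ (u k) (v l)| :=
            Finset.abs_sum_le_sum_abs _ _
        _ ≤ ∑ k ∈ N, (η + (if R k l then 1 else 0)) := by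
            refine Finset.sum_le_sum fun k hk => ?_
            have h4 := abs_le.mp (herr k (hNS k hk).1 l hl)
            rw [abs_le]
            split_ifs at h4 ⊢ <;> constructor <;> linarith [h4.1, h4.2]
        _ = η * N.card + (N.filter fun i => R i l).card := by
            rw [Finset.sum_add_distrib, Finset.sum_const, nsmul_eq_mul, Finset.sum_boole]
            ring
        _ ≤ 2 * η * N.card := by linarith
    have h4 : |inner ℝ c (v l)| ≤ 2 * η := by
      rw [hc, inner_mean, abs_mul, abs_inv, Nat.abs_cast, inv_mul_le_iff₀ hNpos]
      linarith
    have h5 := herr i (hNS i (hPN hi)).1 l hl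
    rw [inner_sub_left]
    calc |inner ℝ (u i) (v l) - inner ℝ c (v l) - if R i l then 1 else 0|
        = |(inner ℝ (u i) (v l) - if R i l then 1 else 0) - inner ℝ c (v l)| := by
          congr 1; ring
      _ ≤ |inner ℝ (u i) (v l) - if R i l then 1 else 0| + |inner ℝ c (v l)| := abs_sub _ _
      _ ≤ 4 * η := by linarith

open Classical in
/-- The vectors of the rows in `P` can be replaced by vectors of square norm at most `a` whose
inner products with the vectors of the columns of `T`, apart from `P'` and a set of columns of
relative size at most `K` times that of `P`, agree with `R` up to `η`. -/
def IsShiftable {ι κ E : Type*} [NormedAddCommGroup E] [InnerProductSpace ℝ E]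
    (R : ι → κ → Prop) (S : Finset ι) (T : Finset κ) (v : κ → E) (K a η : ℝ) (P : Finset ι)
    (P' : Finset κ) : Prop :=
  ∃ Q ⊆ T, (Q.card * S.card : ℝ) ≤ K * (P.card * T.card) ∧
    ∃ u' : ι → E, ∀ i ∈ P, ‖u' i‖ ^ 2 ≤ a ∧
      ∀ l ∈ T, l ∉ Q → l ∉ P' → |inner ℝ (u' i) (v l) - if R i l then 1 else 0| ≤ η

section

variable {ι κ E : Type*} [NormedAddCommGroup E] [InnerProductSpace ℝ E]

theorem IsShiftable.mono {R : ι → κ → Prop} {S : Finset ι} {T : Finset κ} {v : κ → E}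
    {K a η : ℝ} {P : Finset ι} {P' P'' : Finset κ} (h : IsShiftable R S T v K a η P P')
    (hP : P' ⊆ P'') : IsShiftable R S T v K a η P P'' := by
  obtain ⟨Q, hQ, hcard, u', hu'⟩ := h
  exact ⟨Q, hQ, hcard, u', fun i hi =>
    ⟨(hu' i hi).1, fun l hl hlQ hlP => (hu' i hi).2 l hl hlQ fun h => hlP (hP h)⟩⟩

theorem isShiftable_empty (R : ι → κ → Prop) (S : Finset ι) (T : Finset κ) (v : κ → E)
    (K a η : ℝ) (P' : Finset κ) : IsShiftable R S T v K a η ∅ P' :=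
  ⟨∅, Finset.empty_subset _, by simp, 0, fun i hi => absurd hi (Finset.notMem_empty i)⟩

open Classical in
-- `exists_cluster`, applied inside the remaining rectangle, gives new rows disjoint from `P`, so
-- the bounds on the exceptional columns add up with the same ratio. The new rows all meet the
-- single column `j`, whose degree is at most |S|/W, so the cap is overshot at most by a factor 2.
theorem IsShiftable.exists_extension {R : ι → κ → Prop} {S : Finset ι} {T : Finset κ} {u : ι → E}
    {v : κ → E} {L a η W : ℝ} {P : Finset ι} {P' : Finset κ} (hL : 0 < L) (hη0 : 0 < η)
    (hηle : η ≤ 1 / 4) (haL : a ≤ L) (hW : 0 ≤ W)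
    (hu : ∀ i ∈ S, ‖u i‖ ^ 2 ≤ a) (hv : ∀ l ∈ T, ‖v l‖ ^ 2 ≤ L)
    (herr : ∀ i ∈ S, ∀ l ∈ T, |inner ℝ (u i) (v l) - if R i l then 1 else 0| ≤ η)
    (hdeg : ∀ l ∈ T, (S.filter fun i => R i l).card * W ≤ S.card) (hPS : P ⊆ S)
    (h : IsShiftable R S T v (8 * L ^ 2 / η) (a - 1 / (8 * L)) (4 * η) P P')
    (hcap : P.card * W ≤ S.card) {j : κ} (hj : j ∈ T \ P')
    (hne : ((S \ P).filter fun i => R i j).Nonempty)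
    (hmax : ∀ i ∈ S \ P, (((T \ P').filter fun l => R i l).card * S.card : ℝ) ≤
      ((S \ P).filter fun i => R i j).card * T.card) :
    ∃ P₁, P ⊂ P₁ ∧ P₁ ⊆ S ∧ P₁.card * W ≤ 2 * S.card ∧
      IsShiftable R S T v (8 * L ^ 2 / η) (a - 1 / (8 * L)) (4 * η) P₁ P' := by
  obtain ⟨P₀, hP₀, hP₀ne, Q₀, hQ₀, hQ₀card, c, hc⟩ := exists_cluster R (S \ P) (T \ P') u v hL hη0
    hηle (Nat.cast_nonneg S.card) (Nat.cast_nonneg T.card) haL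
    (fun i hi => hu i (Finset.mem_sdiff.mp hi).1) (fun i hi => hv i (Finset.mem_sdiff.mp hi).1)
    (fun i hi l hl => herr i (Finset.mem_sdiff.mp hi).1 l (Finset.mem_sdiff.mp hl).1) hj hne hmax
  obtain ⟨Q, hQ, hQcard, u', hu'⟩ := h
  have hP₀S : P₀ ⊆ S \ P := hP₀.trans (Finset.filter_subset _ _)
  have hdisj : Disjoint P P₀ := by
    rw [Finset.disjoint_left]
    intro i hi hi₀
    exact (Finset.mem_sdiff.mp (hP₀S hi₀)).2 hi
  have hcardU : ((P ∪ P₀).card : ℝ) = P.card + P₀.card := by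
    exact_mod_cast Finset.card_union_of_disjoint hdisj
  refine ⟨P ∪ P₀, ?_, Finset.union_subset hPS (hP₀S.trans Finset.sdiff_subset), ?_, Q ∪ Q₀,
    Finset.union_subset hQ (hQ₀.trans Finset.sdiff_subset), ?_,
    fun i => if i ∈ P then u' i else u i - c, fun i hi => ?_⟩
  · refine Finset.ssubset_iff_subset_ne.mpr ⟨Finset.subset_union_left, fun heq => ?_⟩
    obtain ⟨i, hi⟩ := hP₀ne
    exact (Finset.disjoint_left.mp hdisj) (heq ▸ Finset.mem_union_right P hi) hi
  · have h1 : (P₀.card : ℝ) * W ≤ S.card := by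
      refine le_trans ?_ (hdeg j (Finset.mem_sdiff.mp hj).1)
      gcongr
      exact hP₀.trans (Finset.filter_subset_filter _ Finset.sdiff_subset)
    rw [hcardU]
    linarith
  · have h1 : ((Q ∪ Q₀).card : ℝ) ≤ Q.card + Q₀.card := by
      exact_mod_cast Finset.card_union_le _ _
    calc ((Q ∪ Q₀).card * S.card : ℝ) ≤ (Q.card + Q₀.card) * S.card := by gcongr
      _ = Q.card * S.card + Q₀.card * S.card := by ring
      _ ≤ 8 * L ^ 2 / η * (P.card * T.card) + 8 * L ^ 2 / η * (P₀.card * T.card) :=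
        add_le_add hQcard hQ₀card
      _ = 8 * L ^ 2 / η * ((P ∪ P₀).card * T.card) := by rw [hcardU]; ring
  · by_cases hiP : i ∈ P
    · simp only [if_pos hiP]
      refine ⟨(hu' i hiP).1, fun l hl hlQ hlP => (hu' i hiP).2 l hl (fun h => hlQ ?_) hlP⟩
      exact Finset.mem_union_left _ h
    · have hi₀ : i ∈ P₀ := (Finset.mem_union.mp hi).resolve_left hiP
      simp only [if_neg hiP]
      refine ⟨(hc i hi₀).1, fun l hl hlQ hlP => (hc i hi₀).2 l (Finset.mem_sdiff.mpr ⟨hl, hlP⟩)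
        (fun h => hlQ (Finset.mem_union_right _ h))⟩

open Classical in
/-- Once the shiftable rows make up a positive proportion, they can be shifted with respect to a
positive proportion of the columns. -/
theorem IsShiftable.exists_rectangle {R : ι → κ → Prop} {S : Finset ι} {T : Finset κ}
    {v : κ → E} {K a η W : ℝ} {P : Finset ι} {P' : Finset κ} (hS : S.Nonempty)
    (hK : 0 ≤ K) (hWK : 8 * K ≤ W) (hW : 4 ≤ W) (h : IsShiftable R S T v K a η P P')
    (hP : P.card * W ≤ 2 * S.card) (hP' : P'.card * W ≤ T.card) :
    ∃ T' ⊆ T, (T.card : ℝ) ≤ W * T'.card ∧ ∃ u' : ι → E, ∀ i ∈ P, ‖u' i‖ ^ 2 ≤ a ∧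
      ∀ l ∈ T', |inner ℝ (u' i) (v l) - if R i l then 1 else 0| ≤ η := by
  obtain ⟨Q, hQ, hQcard, u', hu'⟩ := h
  have hSpos : 0 < (S.card : ℝ) := by exact_mod_cast hS.card_pos
  refine ⟨T \ (Q ∪ P'), Finset.sdiff_subset, ?_, u', fun i hi => ⟨(hu' i hi).1, fun l hl => ?_⟩⟩
  -- `Q` and `P'` each take up at most a quarter of `T`: the relative sizes are at most 2K/W and
  -- 1/W.
  · have h1 : (Q.card : ℝ) * W ≤ 2 * K * T.card := by
      refine le_of_mul_le_mul_right ?_ hSpos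
      calc (Q.card : ℝ) * W * S.card = Q.card * S.card * W := by ring
        _ ≤ K * (P.card * T.card) * W := by gcongr
        _ = K * T.card * (P.card * W) := by ring
        _ ≤ K * T.card * (2 * S.card) := by gcongr
        _ = _ := by ring
    have h2 : (T.card : ℝ) ≤ (T \ (Q ∪ P')).card + (Q.card + P'.card) := by
      have h3 := Finset.card_le_card_sdiff_add_card (s := T) (t := Q ∪ P')
      have h4 := Finset.card_union_le Q P'
      exact_mod_cast h3.trans (Nat.add_le_add_left h4 _)
    have h5 : (0 : ℝ) ≤ T.card := Nat.cast_nonneg _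
    nlinarith
  · simp only [Finset.mem_sdiff, Finset.mem_union, not_or] at hl
    exact (hu' i hi).2 l hl.1 hl.2.1 hl.2.2

open Classical in
/-- A sparse approximately factorized relation either vanishes on a large rectangle, or the vectors
of its rows, or those of its columns, can be shortened on a large rectangle. -/
theorem exists_empty_rectangle_or_shift (R : ι → κ → Prop) (S : Finset ι) (T : Finset κ)
    (u : ι → E) (v : κ → E) {L a b η W : ℝ} (hL : 0 < L) (hη0 : 0 < η) (hηle : η ≤ 1 / 4)
    (haL : a ≤ L) (hbL : b ≤ L) (hWK : 8 * (8 * L ^ 2 / η) ≤ W) (hW : 4 ≤ W)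
    (hS : S.Nonempty) (hT : T.Nonempty)
    (hu : ∀ i ∈ S, ‖u i‖ ^ 2 ≤ a) (hv : ∀ l ∈ T, ‖v l‖ ^ 2 ≤ b)
    (herr : ∀ i ∈ S, ∀ l ∈ T, |inner ℝ (u i) (v l) - if R i l then 1 else 0| ≤ η)
    (hcol : ∀ l ∈ T, (S.filter fun i => R i l).card * W ≤ S.card)
    (hrow : ∀ i ∈ S, (T.filter fun l => R i l).card * W ≤ T.card) :
    ∃ S' ⊆ S, ∃ T' ⊆ T, (S.card : ℝ) ≤ W * S'.card ∧ (T.card : ℝ) ≤ W * T'.card ∧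
      ((∀ i ∈ S', ∀ l ∈ T', ¬ R i l) ∨
      (∃ u' : ι → E, ∀ i ∈ S', ‖u' i‖ ^ 2 ≤ a - 1 / (8 * L) ∧
        ∀ l ∈ T', |inner ℝ (u' i) (v l) - if R i l then 1 else 0| ≤ 4 * η) ∨
      ∃ v' : κ → E, ∀ l ∈ T', ‖v' l‖ ^ 2 ≤ b - 1 / (8 * L) ∧
        ∀ i ∈ S', |inner ℝ (v' l) (u i) - if R i l then 1 else 0| ≤ 4 * η) := by
  have hSpos : 0 < (S.card : ℝ) := by exact_mod_cast hS.card_pos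
  have hTpos : 0 < (T.card : ℝ) := by exact_mod_cast hT.card_pos
  have hK : 0 ≤ 8 * L ^ 2 / η := by positivity
  -- Rows and columns are absorbed together, each shifted only with respect to what the other side
  -- has not absorbed. By `IsShiftable.mono`, enlarging one side preserves the other, so a pair of
  -- maximal total size below the caps is useful.
  let Φ : Finset ι × Finset κ → Prop := fun x =>
    (x.1.card * W < S.card ∧ x.2.card * W < T.card) ∧
    IsShiftable R S T v (8 * L ^ 2 / η) (a - 1 / (8 * L)) (4 * η) x.1 x.2 ∧
    IsShiftable (fun l i => R i l) T S u (8 * L ^ 2 / η) (b - 1 / (8 * L)) (4 * η) x.2 x.1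
  obtain ⟨⟨P, P'⟩, hmem, hmaxi⟩ := Finset.exists_max_image
    ((S.powerset ×ˢ T.powerset).filter Φ) (fun x => x.1.card + x.2.card)
    ⟨(∅, ∅), by
      simp only [Finset.mem_filter, Finset.mem_product, Finset.mem_powerset,
        Finset.empty_subset, and_self, true_and]
      exact ⟨by simpa using ⟨hS, hT⟩, isShiftable_empty .., isShiftable_empty ..⟩⟩
  simp only [Finset.mem_filter, Finset.mem_product, Finset.mem_powerset] at hmem hmaxi
  obtain ⟨⟨hPS, hP'T⟩, ⟨hcapP, hcapP'⟩, hsh, hsh'⟩ := hmem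
  dsimp only at hPS hP'T hcapP hcapP' hsh hsh' hmaxi
  by_cases hzero : ∀ i ∈ S \ P, ∀ l ∈ T \ P', ¬ R i l
  · refine ⟨S \ P, Finset.sdiff_subset, T \ P', Finset.sdiff_subset, ?_, ?_, Or.inl hzero⟩
    · have h1 : (S.card : ℝ) ≤ (S \ P).card + P.card := by
        exact_mod_cast Finset.card_le_card_sdiff_add_card (s := S) (t := P)
      nlinarith
    · have h1 : (T.card : ℝ) ≤ (T \ P').card + P'.card := by
        exact_mod_cast Finset.card_le_card_sdiff_add_card (s := T) (t := P')
      nlinarith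
  · push Not at hzero
    obtain ⟨i₀, hi₀, l₀, hl₀, hR₀⟩ := hzero
    obtain ⟨j, hj, hjmax⟩ := Finset.exists_max_image (T \ P')
      (fun l => ((S \ P).filter fun i => R i l).card) ⟨l₀, hl₀⟩
    obtain ⟨k, hk, hkmax⟩ := Finset.exists_max_image (S \ P)
      (fun i => ((T \ P').filter fun l => R i l).card) ⟨i₀, hi₀⟩
    -- Whichever of the best row and best column has the larger normalized degree dominates all
    -- lines of the other kind, as `exists_extension` requires.
    rcases le_total ((((T \ P').filter fun l => R k l).card : ℝ) * S.card)
      (((S \ P).filter fun i => R i j).card * T.card) with hle | hle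
    · have hne : ((S \ P).filter fun i => R i j).Nonempty := by
        rw [← Finset.card_pos]
        refine lt_of_lt_of_le ?_ (hjmax l₀ hl₀)
        exact Finset.card_pos.mpr ⟨i₀, Finset.mem_filter.mpr ⟨hi₀, hR₀⟩⟩
      obtain ⟨P₁, hPP₁, hP₁S, hP₁W, hsh₁⟩ := hsh.exists_extension hL hη0 hηle haL (by linarith) hu
        (fun l hl => (hv l hl).trans hbL) herr hcol hPS hcapP.le hj hne
        (fun i hi => le_trans (by have := hkmax i hi; gcongr) hle)
      -- By maximality the extension must break the cap, so it contains a proportion 1/W of the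
      -- rows.
      have hbig : (S.card : ℝ) ≤ P₁.card * W := by
        by_contra! hlt
        have := hmaxi (P₁, P') ⟨⟨hP₁S, hP'T⟩, ⟨hlt, hcapP'⟩, hsh₁, hsh'.mono hPP₁.subset⟩
        have h2 := Finset.card_lt_card hPP₁
        dsimp only at this
        omega
      obtain ⟨T', hT'T, hT'card, u', hu'⟩ := hsh₁.exists_rectangle hS hK hWK hW hP₁W hcapP'.le
      exact ⟨P₁, hP₁S, T', hT'T, by linarith, hT'card, Or.inr (Or.inl ⟨u', hu'⟩)⟩
    · have hne : ((T \ P').filter fun l => R k l).Nonempty := by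
        rw [← Finset.card_pos]
        refine lt_of_lt_of_le ?_ (hkmax i₀ hi₀)
        exact Finset.card_pos.mpr ⟨l₀, Finset.mem_filter.mpr ⟨hl₀, hR₀⟩⟩
      obtain ⟨P₁, hPP₁, hP₁T, hP₁W, hsh₁⟩ := hsh'.exists_extension hL hη0 hηle hbL (by linarith) hv
        (fun i hi => (hu i hi).trans haL)
        (fun l hl i hi => by rw [real_inner_comm]; exact herr i hi l hl) hrow hP'T hcapP'.le hk hne
        (fun l hl => le_trans (by have := hjmax l hl; gcongr) hle)
      have hbig : (T.card : ℝ) ≤ P₁.card * W := by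
        by_contra! hlt
        have := hmaxi (P, P₁) ⟨⟨hPS, hP₁T⟩, ⟨hcapP, hlt⟩, hsh.mono hPP₁.subset, hsh₁⟩
        have h2 := Finset.card_lt_card hPP₁
        dsimp only at this
        omega
      obtain ⟨S', hS'S, hS'card, v', hv'⟩ := hsh₁.exists_rectangle hT hK hWK hW hP₁W hcapP.le
      exact ⟨S', hS'S, P₁, hP₁T, hS'card, by linarith, Or.inr (Or.inr ⟨v', hv'⟩)⟩

open Classical in
/-- A sparse relation that is approximated by inner products of bounded vectors vanishes on a large
rectangle. -/
theorem exists_empty_rectangle (R : ι → κ → Prop) {L W : ℝ} (hL : 0 < L) (hW : 4 ≤ W) (p : ℕ)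
    (hWp : 64 * L ^ 2 * 4 ^ (p + 1) ≤ W) :
    ∀ (S : Finset ι) (T : Finset κ) (u : ι → E) (v : κ → E) (a b : ℝ), a ≤ L → b ≤ L →
      8 * L * (a + b) ≤ p → (∀ i ∈ S, ‖u i‖ ^ 2 ≤ a) → (∀ l ∈ T, ‖v l‖ ^ 2 ≤ b) →
      (∀ i ∈ S, ∀ l ∈ T, |inner ℝ (u i) (v l) - if R i l then 1 else 0| ≤
        (1 / 4 : ℝ) ^ (p + 1)) →
      (∀ l ∈ T, (S.filter fun i => R i l).card * W ^ p ≤ S.card) →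
      (∀ i ∈ S, (T.filter fun l => R i l).card * W ^ p ≤ T.card) →
      ∃ S' ⊆ S, ∃ T' ⊆ T, (S.card : ℝ) ≤ W ^ p * S'.card ∧ (T.card : ℝ) ≤ W ^ p * T'.card ∧
        ∀ i ∈ S', ∀ l ∈ T', ¬ R i l := by
  induction p with
  | zero =>
    intro S T u v a b haL hbL hab hu hv herr _ _
    refine ⟨S, subset_rfl, T, subset_rfl, by simp, by simp, fun i hi l hl hR => ?_⟩
    have ha : 0 ≤ a := (sq_nonneg _).trans (hu i hi)
    have hb : 0 ≤ b := (sq_nonneg _).trans (hv l hl)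
    have h0 : a + b ≤ 0 := by
      by_contra! h
      have : 0 < 8 * L * (a + b) := by positivity
      simp only [Nat.cast_zero] at hab
      linarith
    have h1 : u i = 0 := by
      have h3 : ‖u i‖ ^ 2 = 0 := le_antisymm (by linarith [hu i hi]) (sq_nonneg _)
      simpa using h3
    have h2 := herr i hi l hl
    rw [h1, inner_zero_left, if_pos hR] at h2
    norm_num at h2
  | succ p ih =>
    intro S T u v a b haL hbL hab hu hv herr hcol hrow
    rcases S.eq_empty_or_nonempty with rfl | hS
    · exact ⟨∅, subset_rfl, T, subset_rfl, by simp,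
        le_mul_of_one_le_left (by positivity) (one_le_pow₀ (by linarith)), by simp⟩
    rcases T.eq_empty_or_nonempty with rfl | hT
    · exact ⟨S, subset_rfl, ∅, subset_rfl,
        le_mul_of_one_le_left (by positivity) (one_le_pow₀ (by linarith)), by simp, by simp⟩
    have hW0 : 0 < W := by linarith
    have hWpow : W ≤ W ^ (p + 1) := le_self_pow₀ (by linarith) (by omega)
    have hη0 : 0 < (1 / 4 : ℝ) ^ (p + 1 + 1) := by positivity
    have hη4 : 4 * (1 / 4 : ℝ) ^ (p + 1 + 1) = (1 / 4 : ℝ) ^ (p + 1) := by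
      rw [pow_succ _ (p + 1)]; ring
    have hηle : (1 / 4 : ℝ) ^ (p + 1 + 1) ≤ 1 / 4 := by
      rw [pow_succ]
      have : (1 / 4 : ℝ) ^ (p + 1) ≤ 1 := pow_le_one₀ (by norm_num) (by norm_num)
      linarith
    obtain ⟨S₁, hS₁, T₁, hT₁, hS₁card, hT₁card, hcase⟩ :=
      exists_empty_rectangle_or_shift R S T u v hL hη0 hηle haL hbL
      (by
        refine le_trans (le_of_eq ?_) hWp
        rw [one_div, inv_pow, div_inv_eq_mul]; ring) hW hS hT hu hv herr
      (fun l hl => le_trans (by gcongr) (hcol l hl)) (fun i hi => le_trans (by gcongr) (hrow i hi))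
    have hδ : 0 < 1 / (8 * L) := by positivity
    have hab' : 8 * L * (a + b - 1 / (8 * L)) ≤ p := by
      have : 8 * L * (a + b - 1 / (8 * L)) = 8 * L * (a + b) - 1 := by field_simp
      rw [this]; push_cast at hab; linarith
    have hWp' : 64 * L ^ 2 * 4 ^ (p + 1) ≤ W := by
      refine le_trans ?_ hWp
      gcongr
      · norm_num
      · omega
    -- Each side shrinks at most by a factor `W`, so densities grow at most by `W`: one power of `W`
    -- is spent per level.
    have hcol₁ : ∀ l ∈ T₁, ((S₁.filter fun i => R i l).card : ℝ) * W ^ p ≤ S₁.card := by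
      intro l hl
      refine le_of_mul_le_mul_right ?_ hW0
      calc ((S₁.filter fun i => R i l).card : ℝ) * W ^ p * W
          = (S₁.filter fun i => R i l).card * W ^ (p + 1) := by ring
        _ ≤ (S.filter fun i => R i l).card * W ^ (p + 1) := by gcongr
        _ ≤ S.card := hcol l (hT₁ hl)
        _ ≤ S₁.card * W := by linarith
    have hrow₁ : ∀ i ∈ S₁, ((T₁.filter fun l => R i l).card : ℝ) * W ^ p ≤ T₁.card := by
      intro i hi
      refine le_of_mul_le_mul_right ?_ hW0
      calc ((T₁.filter fun l => R i l).card : ℝ) * W ^ p * W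
          = (T₁.filter fun l => R i l).card * W ^ (p + 1) := by ring
        _ ≤ (T.filter fun l => R i l).card * W ^ (p + 1) := by gcongr
        _ ≤ T.card := hrow i (hS₁ hi)
        _ ≤ T₁.card * W := by linarith
    have finish : (∃ S' ⊆ S₁, ∃ T' ⊆ T₁, (S₁.card : ℝ) ≤ W ^ p * S'.card ∧
        (T₁.card : ℝ) ≤ W ^ p * T'.card ∧ ∀ i ∈ S', ∀ l ∈ T', ¬ R i l) →
        ∃ S' ⊆ S, ∃ T' ⊆ T, (S.card : ℝ) ≤ W ^ (p + 1) * S'.card ∧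
          (T.card : ℝ) ≤ W ^ (p + 1) * T'.card ∧ ∀ i ∈ S', ∀ l ∈ T', ¬ R i l := by
      rintro ⟨S', hS', T', hT', h1, h2, h3⟩
      refine ⟨S', hS'.trans hS₁, T', hT'.trans hT₁, ?_, ?_, h3⟩
      · calc (S.card : ℝ) ≤ W * S₁.card := hS₁card
          _ ≤ W * (W ^ p * S'.card) := by gcongr
          _ = _ := by ring
      · calc (T.card : ℝ) ≤ W * T₁.card := hT₁card
          _ ≤ W * (W ^ p * T'.card) := by gcongr
          _ = _ := by ring
    apply finish
    rcases hcase with h | ⟨u', hu'⟩ | ⟨v', hv'⟩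
    · exact ⟨S₁, subset_rfl, T₁, subset_rfl,
        le_mul_of_one_le_left (by positivity) (one_le_pow₀ (by linarith)),
        le_mul_of_one_le_left (by positivity) (one_le_pow₀ (by linarith)), h⟩
    · rw [hη4] at hu'
      exact ih hWp' S₁ T₁ u' v (a - 1 / (8 * L)) b (by linarith) hbL
        (le_trans (le_of_eq (by ring)) hab') (fun i hi => (hu' i hi).1)
        (fun l hl => hv l (hT₁ hl)) (fun i hi => (hu' i hi).2) hcol₁ hrow₁
    · rw [hη4] at hv'
      exact ih hWp' S₁ T₁ u v' a (b - 1 / (8 * L)) haL (by linarith)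
        (le_trans (le_of_eq (by ring)) hab') (fun i hi => hu i (hS₁ hi))
        (fun l hl => (hv' l hl).1)
        (fun i hi l hl => by rw [real_inner_comm]; exact (hv' l hl).2 i hi) hcol₁ hrow₁

end

/-! ### The complementary relation and averaging -/

/-- This factorizes the complement of a 0/1 relation at the cost of 1 in each squared norm. -/
theorem inner_toLp_one {E : Type*} [NormedAddCommGroup E] [InnerProductSpace ℝ E] (x y : E) :
    inner ℝ (WithLp.toLp 2 (x, (1 : ℝ))) (WithLp.toLp 2 (-y, (1 : ℝ))) = 1 - inner ℝ x y := by
  rw [WithLp.prod_inner_apply]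
  simp
  ring

theorem norm_toLp_one_sq {E : Type*} [NormedAddCommGroup E] [InnerProductSpace ℝ E] (x : E) :
    ‖(WithLp.toLp 2 (x, (1 : ℝ)) : WithLp 2 (E × ℝ))‖ ^ 2 = ‖x‖ ^ 2 + 1 := by
  rw [WithLp.prod_norm_sq_eq_of_L2]
  simp

open Classical in
-- The average density is at least 1/B, while nearly empty rows contribute at most 1/Y ≤ 1/(2B). The
-- nearly full rows must supply the rest.
theorem card_le_of_dense_of_dichotomy {ι κ : Type*} (R : ι → κ → Prop) (N : Finset ι)
    (T : Finset κ) {B : ℝ} {Y : ℕ} (hT : T.Nonempty) (hB : 0 < B) (hY : 2 * B ≤ Y)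
    (hdense : ∀ l ∈ T, N.card ≤ B * (N.filter fun i => R i l).card)
    (hconst : ∀ i ∈ N, Y * (T.filter fun j => R i j).card ≤ T.card ∨
      Y * (T.filter fun j => ¬ R i j).card ≤ T.card) :
    (N.card : ℝ) ≤ 2 * B *
      (N.filter fun i => Y * (T.filter fun j => ¬ R i j).card ≤ T.card).card := by
  have hTpos : 0 < (T.card : ℝ) := by exact_mod_cast hT.card_pos
  have hY0 : 0 < (Y : ℝ) := by linarith
  obtain ⟨S, hS⟩ : ∃ S, S = N.filter fun i => Y * (T.filter fun j => ¬ R i j).card ≤ T.card :=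
    ⟨_, rfl⟩
  rw [← hS]
  have h1 : ((T.card : ℝ) * N.card) ≤ B * ∑ i ∈ N, ((T.filter fun j => R i j).card : ℝ) := by
    calc ((T.card : ℝ) * N.card) = ∑ l ∈ T, (N.card : ℝ) := by
          rw [Finset.sum_const, nsmul_eq_mul]
      _ ≤ ∑ l ∈ T, B * ((N.filter fun i => R i l).card : ℝ) := Finset.sum_le_sum hdense
      _ = B * ((∑ l ∈ T, (N.filter fun i => R i l).card : ℕ) : ℝ) := by
          rw [← Finset.mul_sum]; push_cast; rfl
      _ = _ := by rw [← sum_card_filter_comm N T R]; push_cast; rfl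
  have h2 : ∑ i ∈ N, ((T.filter fun j => R i j).card : ℝ) ≤
      S.card * T.card + N.card * (T.card / Y) := by
    calc ∑ i ∈ N, ((T.filter fun j => R i j).card : ℝ)
        ≤ ∑ i ∈ N, ((if Y * (T.filter fun j => ¬ R i j).card ≤ T.card then (T.card : ℝ) else 0) +
            T.card / Y) := by
          refine Finset.sum_le_sum fun i hi => ?_
          split_ifs with h
          · have : ((T.filter fun j => R i j).card : ℝ) ≤ T.card := by
              exact_mod_cast Finset.card_filter_le _ _
            have : (0 : ℝ) ≤ T.card / Y := by positivity
            linarith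
          · have h3 := (hconst i hi).resolve_right h
            rw [zero_add, le_div_iff₀ hY0, mul_comm]
            exact_mod_cast h3
      _ = _ := by
          rw [Finset.sum_add_distrib, ← Finset.sum_filter, ← hS, Finset.sum_const,
            Finset.sum_const, nsmul_eq_mul, nsmul_eq_mul]
  have h3 : B * (N.card * (T.card / Y)) ≤ N.card * T.card / 2 := by
    rw [mul_div_assoc', mul_div_assoc', div_le_div_iff₀ hY0 (by norm_num)]
    have : (0 : ℝ) ≤ N.card * T.card := by positivity
    nlinarith
  have h4 : (N.card : ℝ) * T.card ≤ 2 * B * S.card * T.card := by nlinarith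
  exact le_of_mul_le_mul_right h4 hTpos

/-- Markov's inequality: a bound on row densities becomes one on the densities of at least half of
the columns. -/
theorem card_le_two_mul_card_filter {ι κ : Type*} (R : ι → κ → Prop)
    [∀ i j, Decidable (R i j)] (S : Finset ι)
    (T : Finset κ) {Y : ℕ} (hS : S.Nonempty)
    (h : ∀ i ∈ S, Y * (T.filter fun j => R i j).card ≤ T.card) :
    T.card ≤ 2 * (T.filter fun j => Y * (S.filter fun i => R i j).card ≤ 2 * S.card).card := by
  have h1 : Y * ∑ j ∈ T, (S.filter fun i => R i j).card ≤ S.card * T.card := by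
    rw [← sum_card_filter_comm S T R, Finset.mul_sum, ← smul_eq_mul, ← Finset.sum_const]
    exact Finset.sum_le_sum h
  have h2 : (T.filter fun j => ¬ Y * (S.filter fun i => R i j).card ≤ 2 * S.card).card *
      (2 * S.card) ≤ Y * ∑ j ∈ T, (S.filter fun i => R i j).card := by
    rw [← smul_eq_mul, ← Finset.sum_const, Finset.mul_sum]
    refine (Finset.sum_le_sum fun j hj => ?_).trans
      (Finset.sum_le_sum_of_subset (Finset.filter_subset _ _))
    exact (not_le.mp (Finset.mem_filter.mp hj).2).le
  have h3 := Finset.card_filter_add_card_filter_not (s := T)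
    (fun j => Y * (S.filter fun i => R i j).card ≤ 2 * S.card)
  have h4 : (2 * (T.filter fun j => ¬ Y * (S.filter fun i => R i j).card ≤ 2 * S.card).card) *
      S.card ≤ T.card * S.card := by
    calc _ = _ := by ring
      _ ≤ _ := h2.trans h1
      _ = _ := by ring
  have h5 := Nat.le_of_mul_le_mul_right h4 hS.card_pos
  omega

/-! ### Numerical bounds on the constants -/

section

variable {M : ℕ}

theorem le_two_pow_sq (hM : 2 ≤ M) : 64 * M ^ 2 * 4 ^ (16 * M ^ 2 + 1) ≤ 2 ^ (40 * M ^ 2) := by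
  calc 64 * M ^ 2 * 4 ^ (16 * M ^ 2 + 1) ≤ 2 ^ 6 * (2 ^ M) ^ 2 * (2 ^ 2) ^ (16 * M ^ 2 + 1) := by
        gcongr
        · norm_num
        · exact Nat.lt_two_pow_self.le
        · norm_num
    _ = 2 ^ (6 + M * 2 + 2 * (16 * M ^ 2 + 1)) := by
        simp only [← pow_mul, ← pow_add]
    _ ≤ 2 ^ (40 * M ^ 2) := by
        apply Nat.pow_le_pow_right (by norm_num)
        nlinarith

theorem two_add_mul_le (hM : 2 ≤ M) : 2 + M * 4 ^ (8 * M ^ 2 + 1) ≤ 2 ^ (18 * M ^ 2) := by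
  calc 2 + M * 4 ^ (8 * M ^ 2 + 1) ≤ M * 4 ^ (8 * M ^ 2 + 1) + M * 4 ^ (8 * M ^ 2 + 1) := by
        have : 1 ≤ 4 ^ (8 * M ^ 2 + 1) := Nat.one_le_pow _ _ (by norm_num)
        nlinarith
    _ = 2 ^ 1 * M * (2 ^ 2) ^ (8 * M ^ 2 + 1) := by norm_num; ring
    _ ≤ 2 ^ 1 * 2 ^ M * (2 ^ 2) ^ (8 * M ^ 2 + 1) := by
        gcongr
        exact Nat.lt_two_pow_self.le
    _ = 2 ^ (1 + M + 2 * (8 * M ^ 2 + 1)) := by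
        simp only [← pow_mul, ← pow_add]
    _ ≤ 2 ^ (18 * M ^ 2) := by
        apply Nat.pow_le_pow_right (by norm_num)
        nlinarith

theorem four_mul_le (hM : 2 ≤ M) : 4 * (8 * M ^ 2 + 1) ≤ 2 ^ (33 * M ^ 2) :=
  calc 4 * (8 * M ^ 2 + 1) ≤ 33 * M ^ 2 := by nlinarith
    _ ≤ 2 ^ (33 * M ^ 2) := Nat.lt_two_pow_self.le

theorem rows_constant_le (hM : 2 ≤ M) {W : ℕ} (hW : W ≤ 2 ^ (40 * M ^ 2)) :
    4 * (8 * M ^ 2 + 1) * (2 * 4 ^ (8 * M ^ 2 + 1) * W ^ (16 * M ^ 2)) ≤ 2 ^ (4000 * M ^ 6) := by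
  calc 4 * (8 * M ^ 2 + 1) * (2 * 4 ^ (8 * M ^ 2 + 1) * W ^ (16 * M ^ 2))
      ≤ 2 ^ (33 * M ^ 2) * (2 ^ 1 * (2 ^ 2) ^ (8 * M ^ 2 + 1) *
          (2 ^ (40 * M ^ 2)) ^ (16 * M ^ 2)) := by
        gcongr
        · exact four_mul_le hM
        · norm_num
        · norm_num
    _ = 2 ^ (33 * M ^ 2 + (1 + 2 * (8 * M ^ 2 + 1) + 40 * M ^ 2 * (16 * M ^ 2))) := by
        simp only [← pow_mul, ← pow_add]
    _ ≤ 2 ^ (4000 * M ^ 6) := by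
        apply Nat.pow_le_pow_right (by norm_num)
        have h2 : 4 ≤ M ^ 2 := by nlinarith
        have h4 : M ^ 2 * 4 ≤ M ^ 2 * M ^ 2 := by gcongr
        have h6 : M ^ 2 * M ^ 2 * 4 ≤ M ^ 2 * M ^ 2 * M ^ 2 := by gcongr
        have e6 : M ^ 6 = M ^ 2 * M ^ 2 * M ^ 2 := by ring
        rw [e6]
        nlinarith

/-- The dominant factor is the power 4M² of 2·W^(16M²), which contributes about 640M⁴ · 4M² = 2560M⁶
to the exponent. -/
theorem cols_constant_le (hM : 2 ≤ M) {W V : ℕ} (hW : W ≤ 2 ^ (40 * M ^ 2))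
    (hV : V ≤ 2 ^ (18 * M ^ 2)) :
    4 * (8 * M ^ 2 + 1) * V ^ (8 * M ^ 2 + 1) *
      ((2 * W ^ (16 * M ^ 2)) ^ (4 * M ^ 2) * (2 * W ^ (16 * M ^ 2))) ≤ 2 ^ (4000 * M ^ 6) := by
  calc 4 * (8 * M ^ 2 + 1) * V ^ (8 * M ^ 2 + 1) *
        ((2 * W ^ (16 * M ^ 2)) ^ (4 * M ^ 2) * (2 * W ^ (16 * M ^ 2)))
      ≤ 2 ^ (33 * M ^ 2) * (2 ^ (18 * M ^ 2)) ^ (8 * M ^ 2 + 1) *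
        ((2 ^ 1 * (2 ^ (40 * M ^ 2)) ^ (16 * M ^ 2)) ^ (4 * M ^ 2) *
          (2 ^ 1 * (2 ^ (40 * M ^ 2)) ^ (16 * M ^ 2))) := by
        gcongr
        · exact four_mul_le hM
        · norm_num
        · norm_num
    _ = 2 ^ (33 * M ^ 2 + 18 * M ^ 2 * (8 * M ^ 2 + 1) +
          ((1 + 40 * M ^ 2 * (16 * M ^ 2)) * (4 * M ^ 2) + (1 + 40 * M ^ 2 * (16 * M ^ 2)))) := by
        simp only [← pow_mul, ← pow_add]
    _ ≤ 2 ^ (4000 * M ^ 6) := by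
        apply Nat.pow_le_pow_right (by norm_num)
        have h2 : 4 ≤ M ^ 2 := by nlinarith
        have h4 : M ^ 2 * 4 ≤ M ^ 2 * M ^ 2 := by gcongr
        have h6 : M ^ 2 * M ^ 2 * 4 ≤ M ^ 2 * M ^ 2 * M ^ 2 := by gcongr
        have e6 : M ^ 6 = M ^ 2 * M ^ 2 * M ^ 2 := by ring
        rw [e6]
        nlinarith

end

/-! ### Full rectangles -/

open Classical in
/-- A relation given by inner products of bounded vectors contains a full rectangle of size
proportional to the average degrees. -/
theorem exists_full_rectangle {ι κ E : Type*} [NormedAddCommGroup E] [InnerProductSpace ℝ E]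
    (R : ι → κ → Prop) (S : Finset ι) (T : Finset κ) (u : ι → E) (v : κ → E) {M : ℕ} (hM : 2 ≤ M)
    (hu : ∀ i ∈ S, ‖u i‖ ^ 2 + 1 ≤ M) (hv : ∀ l ∈ T, ‖v l‖ ^ 2 + 1 ≤ M)
    (huv : ∀ i ∈ S, ∀ l ∈ T, inner ℝ (u i) (v l) = if R i l then (1 : ℝ) else 0) :
    ∃ S' ⊆ S, ∃ T' ⊆ T, (∀ i ∈ S', ∀ l ∈ T', R i l) ∧
      ((∑ i ∈ S, (T.filter fun l => R i l).card : ℕ) : ℝ) ≤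
        2 ^ (4000 * M ^ 6) * (S'.card * T.card) ∧
      ((∑ i ∈ S, (T.filter fun l => R i l).card : ℕ) : ℝ) ≤
        2 ^ (4000 * M ^ 6) * (T'.card * S.card) := by
  rcases Nat.eq_zero_or_pos (∑ i ∈ S, (T.filter fun l => R i l).card) with h0 | hpos
  · rw [h0]
    exact ⟨∅, Finset.empty_subset _, ∅, Finset.empty_subset _, by simp, by simp, by simp⟩
  have hM0 : (0 : ℝ) < M := by exact_mod_cast (by omega : 0 < M)
  obtain ⟨V, hVdef⟩ : ∃ V, V = 2 + M * 4 ^ (8 * M ^ 2 + 1) := ⟨_, rfl⟩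
  obtain ⟨W, hWdef⟩ : ∃ W, W = 64 * M ^ 2 * 4 ^ (16 * M ^ 2 + 1) := ⟨_, rfl⟩
  -- The exponent 16M² is the energy budget 8M(M + M) of `exists_empty_rectangle`. The factor 2 pays
  -- for the Markov step: column densities double, and half of `T₂` may be dropped.
  obtain ⟨Y, hYdef⟩ : ∃ Y, Y = 2 * W ^ (16 * M ^ 2) := ⟨_, rfl⟩
  have hu' : ∀ i ∈ S, ‖u i‖ ^ 2 ≤ M := fun i hi => by linarith [hu i hi]
  have hv' : ∀ l ∈ T, ‖v l‖ ^ 2 ≤ M := fun l hl => by linarith [hv l hl]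
  have hW4 : 4 * 4 ^ (8 * M ^ 2) ≤ W := by
    rw [hWdef, ← pow_succ']
    calc 4 ^ (8 * M ^ 2 + 1) ≤ 4 ^ (16 * M ^ 2 + 1) :=
          Nat.pow_le_pow_right (by norm_num) (by nlinarith)
      _ ≤ 64 * M ^ 2 * 4 ^ (16 * M ^ 2 + 1) := Nat.le_mul_of_pos_left _ (by positivity)
  have hW4' : 4 ≤ W := le_trans (Nat.le_mul_of_pos_right _ (by positivity)) hW4
  have hY0 : 0 < Y := by rw [hYdef]; positivity
  have hYB : 2 * 4 ^ (8 * M ^ 2 + 1) ≤ Y := by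
    rw [hYdef, pow_succ']
    have : W ≤ W ^ (16 * M ^ 2) := Nat.le_self_pow (by positivity) W
    omega
  obtain ⟨N, hNS, T₁, hT₁, hNne, hN, hT₁card, hdense⟩ := exists_dense_rectangle R S T u v
    (L := M) (V := V) (8 * M ^ 2) hM0 (by push_cast; exact le_of_eq (by ring))
    (by rw [hVdef]; push_cast; exact le_rfl) hu' hv' huv hpos
  have hT₁ne : T₁.Nonempty := by
    rw [Finset.nonempty_iff_ne_empty]
    rintro rfl
    simp only [Finset.card_empty, Nat.cast_zero, zero_mul, mul_zero] at hT₁card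
    have : (0 : ℝ) < ((∑ i ∈ S, (T.filter fun l => R i l).card : ℕ) : ℝ) := by exact_mod_cast hpos
    linarith
  obtain ⟨T₂, hT₂, hT₂ne, hT₂card, hconst⟩ := exists_subset_almost_constant R N u v hM0 hY0
    (fun i hi => hu' i (hNS hi)) (4 * M ^ 2) T₁ 0 M hT₁ne
    (fun i hi l hl => huv i (hNS hi) l (hT₁ hl)) (fun l hl => by
      rw [sub_zero]; exact hv' l (hT₁ hl)) (by push_cast; exact le_of_eq (by ring))
  have hNcard := card_le_of_dense_of_dichotomy R N T₂ (B := 4 ^ (8 * M ^ 2 + 1)) hT₂ne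
    (by positivity) (by exact_mod_cast hYB) (fun l hl => by
      have h := (hdense l (hT₂ hl)).le
      rwa [one_div, inv_pow, inv_mul_le_iff₀ (by positivity)] at h) hconst
  obtain ⟨S₁, hS₁⟩ : ∃ S₁, S₁ = N.filter fun i =>
    Y * (T₂.filter fun j => ¬ R i j).card ≤ T₂.card := ⟨_, rfl⟩
  rw [← hS₁] at hNcard
  have hS₁N : S₁ ⊆ N := hS₁ ▸ Finset.filter_subset _ _
  have hS₁row : ∀ i ∈ S₁, Y * (T₂.filter fun j => ¬ R i j).card ≤ T₂.card := fun i hi => by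
    rw [hS₁] at hi; exact (Finset.mem_filter.mp hi).2
  have hS₁ne : S₁.Nonempty := by
    rw [Finset.nonempty_iff_ne_empty]
    intro h
    rw [h] at hNcard
    simp only [Finset.card_empty, Nat.cast_zero, mul_zero] at hNcard
    have : 0 < (N.card : ℝ) := by exact_mod_cast hNne.card_pos
    linarith
  have hT₃card := card_le_two_mul_card_filter (fun i j => ¬ R i j) S₁ T₂ hS₁ne hS₁row
  obtain ⟨T₃, hT₃⟩ : ∃ T₃, T₃ = T₂.filter fun j =>
    Y * (S₁.filter fun i => ¬ R i j).card ≤ 2 * S₁.card := ⟨_, rfl⟩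
  rw [← hT₃] at hT₃card
  have hT₃T₂ : T₃ ⊆ T₂ := hT₃ ▸ Finset.filter_subset _ _
  have hT₃col : ∀ j ∈ T₃, Y * (S₁.filter fun i => ¬ R i j).card ≤ 2 * S₁.card := fun j hj => by
    rw [hT₃] at hj; exact (Finset.mem_filter.mp hj).2
  obtain ⟨S', hS', T', hT', hS'card, hT'card, hfull⟩ := exists_empty_rectangle
    (fun i l => ¬ R i l) (L := M) (W := W) hM0 (by exact_mod_cast hW4') (16 * M ^ 2)
    (by rw [hWdef]; push_cast; exact le_rfl) S₁ T₃ (fun i => WithLp.toLp 2 (u i, (1 : ℝ)))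
    (fun l => WithLp.toLp 2 (-v l, (1 : ℝ))) M M le_rfl le_rfl
    (by push_cast; exact le_of_eq (by ring))
    (fun i hi => by rw [norm_toLp_one_sq]; exact hu i (hNS (hS₁N hi)))
    (fun l hl => by rw [norm_toLp_one_sq, norm_neg]; exact hv l (hT₁ (hT₂ (hT₃T₂ hl))))
    (fun i hi l hl => by
      rw [inner_toLp_one, huv i (hNS (hS₁N hi)) l (hT₁ (hT₂ (hT₃T₂ hl)))]
      by_cases hR : R i l <;> simp [hR])
    (fun l hl => by
      have h := hT₃col l hl
      rw [hYdef] at h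
      have h1 : (S₁.filter fun i => ¬ R i l).card * W ^ (16 * M ^ 2) ≤ S₁.card := by linarith
      have h2 : ((S₁.filter fun i => ¬ R i l).card : ℝ) * (W : ℝ) ^ (16 * M ^ 2) ≤ S₁.card := by
        exact_mod_cast h1
      convert h2)
    (fun i hi => by
      have h := hS₁row i hi
      have h2 : Y * (T₃.filter fun l => ¬ R i l).card ≤ T₂.card :=
        le_trans (Nat.mul_le_mul_left _ (Finset.card_le_card
          (Finset.filter_subset_filter _ hT₃T₂))) h
      rw [hYdef] at h2
      have h1 : (T₃.filter fun l => ¬ R i l).card * W ^ (16 * M ^ 2) ≤ T₃.card := by linarith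
      have h3 : ((T₃.filter fun l => ¬ R i l).card : ℝ) * (W : ℝ) ^ (16 * M ^ 2) ≤ T₃.card := by
        exact_mod_cast h1
      convert h3)
  refine ⟨S', hS'.trans (hS₁N.trans hNS), T', hT'.trans (hT₃T₂.trans (hT₂.trans hT₁)),
    fun i hi l hl => not_not.mp (hfull i hi l hl), ?_, ?_⟩
  · have hc : (4 * (8 * M ^ 2 + 1) * (2 * 4 ^ (8 * M ^ 2 + 1) * W ^ (16 * M ^ 2)) : ℝ) ≤
        2 ^ (4000 * M ^ 6) := by
      exact_mod_cast rows_constant_le hM (hWdef ▸ le_two_pow_sq hM)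
    calc _ ≤ 4 * (((8 * M ^ 2 : ℕ) : ℝ) + 1) * (N.card * T.card) := hN
      _ ≤ 4 * (((8 * M ^ 2 : ℕ) : ℝ) + 1) *
          (2 * 4 ^ (8 * M ^ 2 + 1) * (W ^ (16 * M ^ 2) * S'.card) * T.card) := by
          gcongr
          exact hNcard.trans (by gcongr)
      _ = (4 * (8 * M ^ 2 + 1) * (2 * 4 ^ (8 * M ^ 2 + 1) * W ^ (16 * M ^ 2)) : ℝ) *
          (S'.card * T.card) := by push_cast; ring
      _ ≤ _ := by gcongr
  · have hc : (4 * (8 * M ^ 2 + 1) * V ^ (8 * M ^ 2 + 1) *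
        (Y ^ (4 * M ^ 2) * (2 * W ^ (16 * M ^ 2))) : ℝ) ≤ 2 ^ (4000 * M ^ 6) := by
      rw [hYdef]
      exact_mod_cast cols_constant_le hM (hWdef ▸ le_two_pow_sq hM) (hVdef ▸ two_add_mul_le hM)
    have h1 : (T₁.card : ℝ) ≤ Y ^ (4 * M ^ 2) * T₂.card := by exact_mod_cast hT₂card
    have h2 : (T₂.card : ℝ) ≤ 2 * T₃.card := by exact_mod_cast hT₃card
    calc _ ≤ 4 * (((8 * M ^ 2 : ℕ) : ℝ) + 1) * V ^ (8 * M ^ 2 + 1) * (T₁.card * S.card) := hT₁card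
      _ ≤ 4 * (((8 * M ^ 2 : ℕ) : ℝ) + 1) * V ^ (8 * M ^ 2 + 1) *
          (Y ^ (4 * M ^ 2) * (2 * (W ^ (16 * M ^ 2) * T'.card)) * S.card) := by
          gcongr
          refine h1.trans ?_
          gcongr
          exact h2.trans (by gcongr)
      _ = (4 * (8 * M ^ 2 + 1) * V ^ (8 * M ^ 2 + 1) *
            (Y ^ (4 * M ^ 2) * (2 * W ^ (16 * M ^ 2))) : ℝ) * (T'.card * S.card) := by
          push_cast; ring
      _ ≤ _ := by gcongr

/-! ### From `gammaTwo` to bounded vectors -/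

theorem norm_row_le_rowNorm {m k : ℕ} (U : Matrix (Fin m) (Fin k) ℝ) (i : Fin m) :
    ‖WithLp.toLp 2 (fun l : Fin k => U i l)‖ ≤ rowNorm U :=
  le_ciSup (f := fun i : Fin m => ‖WithLp.toLp 2 (fun l : Fin k => U i l)‖)
    (Set.finite_range _).bddAbove i

theorem norm_col_le_colNorm {k n : ℕ} (V : Matrix (Fin k) (Fin n) ℝ) (j : Fin n) :
    ‖WithLp.toLp 2 (fun l : Fin k => V l j)‖ ≤ colNorm V :=
  le_ciSup (f := fun j : Fin n => ‖WithLp.toLp 2 (fun l : Fin k => V l j)‖)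
    (Set.finite_range _).bddAbove j

theorem inner_row_col {m n k : ℕ} (U : Matrix (Fin m) (Fin k) ℝ) (V : Matrix (Fin k) (Fin n) ℝ)
    (i : Fin m) (j : Fin n) :
    inner ℝ (WithLp.toLp 2 (fun l : Fin k => U i l)) (WithLp.toLp 2 (fun l : Fin k => V l j)) =
      (U * V) i j := by
  simp [PiLp.inner_apply, Matrix.mul_apply, mul_comm]

/-- A factorization can be rescaled so that its row and column norms agree. -/
theorem exists_balanced_vectors {m n : ℕ} {A : Matrix (Fin m) (Fin n) ℝ} {r : ℝ}
    (hr : r ∈ factorizationValues A) (hr0 : 0 < r) :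
    ∃ (k : ℕ) (u : Fin m → EuclideanSpace ℝ (Fin k)) (v : Fin n → EuclideanSpace ℝ (Fin k)),
      (∀ i, ‖u i‖ ^ 2 ≤ r) ∧ (∀ j, ‖v j‖ ^ 2 ≤ r) ∧ ∀ i j, inner ℝ (u i) (v j) = A i j := by
  obtain ⟨k, U, V, rfl, rfl⟩ := hr
  have hrow : 0 ≤ rowNorm U := Real.iSup_nonneg fun _ => norm_nonneg _
  have hcol : 0 ≤ colNorm V := Real.iSup_nonneg fun _ => norm_nonneg _
  have hrow' : 0 < rowNorm U := by
    rcases hrow.lt_or_eq with h | h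
    · exact h
    · rw [← h, zero_mul] at hr0; exact absurd hr0 (lt_irrefl _)
  have hcol' : 0 < colNorm V := by
    rcases hcol.lt_or_eq with h | h
    · exact h
    · rw [← h, mul_zero] at hr0; exact absurd hr0 (lt_irrefl _)
  obtain ⟨s, hs0, hs⟩ : ∃ s : ℝ, 0 < s ∧ s ^ 2 = colNorm V / rowNorm U :=
    ⟨√(colNorm V / rowNorm U), by positivity, Real.sq_sqrt (by positivity)⟩
  refine ⟨k, fun i => s • WithLp.toLp 2 (fun l : Fin k => U i l),
    fun j => s⁻¹ • WithLp.toLp 2 (fun l : Fin k => V l j), fun i => ?_, fun j => ?_, fun i j => ?_⟩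
  · rw [norm_smul, mul_pow, Real.norm_eq_abs, sq_abs, hs]
    calc colNorm V / rowNorm U * ‖WithLp.toLp 2 (fun l : Fin k => U i l)‖ ^ 2
        ≤ colNorm V / rowNorm U * rowNorm U ^ 2 := by
          gcongr
          exact norm_row_le_rowNorm U i
      _ = rowNorm U * colNorm V := by field_simp
  · rw [norm_smul, mul_pow, Real.norm_eq_abs, sq_abs, inv_pow, hs, inv_div]
    calc rowNorm U / colNorm V * ‖WithLp.toLp 2 (fun l : Fin k => V l j)‖ ^ 2
        ≤ rowNorm U / colNorm V * colNorm V ^ 2 := by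
          gcongr
          exact norm_col_le_colNorm V j
      _ = rowNorm U * colNorm V := by field_simp
  · rw [real_inner_smul_left, real_inner_smul_right, inner_row_col, ← mul_assoc,
      mul_inv_cancel₀ hs0.ne', one_mul]

theorem le_of_mem_factorizationValues {m n : ℕ} {A : Matrix (Fin m) (Fin n) ℝ} {r : ℝ}
    (hr : r ∈ factorizationValues A) (i : Fin m) (j : Fin n) : A i j ≤ r := by
  obtain ⟨k, U, V, rfl, rfl⟩ := hr
  rw [← inner_row_col U V i j]
  refine (real_inner_le_norm _ _).trans ?_
  have := norm_row_le_rowNorm U i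
  have := norm_col_le_colNorm V j
  have : 0 ≤ rowNorm U := Real.iSup_nonneg fun _ => norm_nonneg _
  gcongr

theorem le_gammaTwo {m n : ℕ} (A : Matrix (Fin m) (Fin n) ℝ) (i : Fin m) (j : Fin n) :
    A i j ≤ gammaTwo A :=
  le_csInf (factorizationValues_nonempty A) fun _ hr => le_of_mem_factorizationValues hr i j

theorem numOnes_eq_sum {m n : ℕ} (A : Matrix (Fin m) (Fin n) ℝ) :
    numOnes A = ∑ i, (Finset.univ.filter fun j => A i j = 1).card := by
  simp only [numOnes, Finset.card_filter]
  exact Fintype.sum_prod_type _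

/-- Since M ≤ 2^M, one has 4000·M⁶ ≤ 2^(12 + 6M), and 12 + 6M ≤ 36·lam because lam ≥ 1. This gives C
= 36. -/
theorem two_pow_le_two_rpow {lam : ℝ} (hlam : 1 ≤ lam) {M : ℕ} (hM : (M : ℝ) ≤ 4 * lam) :
    (2 : ℝ) ^ (4000 * M ^ 6) ≤ 2 ^ ((2 : ℝ) ^ (36 * lam)) := by
  rw [← Real.rpow_natCast]
  refine Real.rpow_le_rpow_of_exponent_le (by norm_num) ?_
  have h1 : ((4000 * M ^ 6 : ℕ) : ℝ) ≤ (2 : ℝ) ^ (12 + M * 6) := by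
    have : 4000 * M ^ 6 ≤ 2 ^ 12 * (2 ^ M) ^ 6 := by
      gcongr
      · norm_num
      · exact Nat.lt_two_pow_self.le
    rw [← pow_mul, ← pow_add] at this
    exact_mod_cast this
  refine h1.trans ?_
  rw [← Real.rpow_natCast]
  refine Real.rpow_le_rpow_of_exponent_le (by norm_num) ?_
  push_cast
  linarith

theorem corollary1p5 :
    ∃ C : ℝ, 0 < C ∧ ∃ c : ℝ → ℝ,
      (∀ lam : ℝ, 1 / (2 : ℝ) ^ ((2 : ℝ) ^ (C * lam)) ≤ c lam) ∧
      ∀ (lam : ℝ) (m n : ℕ) (A : Matrix (Fin m) (Fin n) ℝ),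
        IsBoolean A → gammaTwo A ≤ lam →
          ∃ (S : Finset (Fin m)) (T : Finset (Fin n)), IsOneRectangle A S T ∧
            c lam * (numOnes A : ℝ) / (n : ℝ) ≤ (S.card : ℝ) ∧
            c lam * (numOnes A : ℝ) / (m : ℝ) ≤ (T.card : ℝ) := by
  refine ⟨36, by norm_num, fun lam => 1 / (2 : ℝ) ^ ((2 : ℝ) ^ (36 * lam)), fun _ => le_rfl,
    fun lam m n A hA hlam => ?_⟩
  rcases Nat.eq_zero_or_pos (numOnes A) with h0 | hpos
  · refine ⟨∅, ∅, fun i hi => absurd hi (Finset.notMem_empty i), ?_, ?_⟩ <;> simp [h0]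
  obtain ⟨⟨i₀, j₀⟩, hij⟩ := Finset.card_pos.mp hpos
  have hij' : A i₀ j₀ = 1 := (Finset.mem_filter.mp hij).2
  -- Entries are at most γ₂ by Cauchy–Schwarz, so a single 1-entry forces lam ≥ 1. This lets a
  -- multiple of `lam` absorb additive constants.
  have hlam1 : 1 ≤ lam := by
    rw [← hij']; exact (le_gammaTwo A i₀ j₀).trans hlam
  -- Slack 1 makes it unnecessary to know that the infimum is attained.
  obtain ⟨r, hr, hrlt⟩ := exists_lt_of_csInf_lt (factorizationValues_nonempty A)
    (lt_of_le_of_lt hlam (lt_add_one lam))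
  have hr1 : 1 ≤ r := by rw [← hij']; exact le_of_mem_factorizationValues hr i₀ j₀
  obtain ⟨k, u, v, hu, hv, huv⟩ := exists_balanced_vectors hr (by linarith)
  -- The extra 1 leaves room for the coordinate added when passing to the complement; still M < lam
  -- + 3 ≤ 4·lam.
  obtain ⟨M, hMdef⟩ : ∃ M, M = ⌈r⌉₊ + 1 := ⟨_, rfl⟩
  have hrM : r + 1 ≤ M := by
    rw [hMdef]; push_cast; linarith [Nat.le_ceil r]
  have hMle : (M : ℝ) ≤ 4 * lam := by
    rw [hMdef]; push_cast; linarith [Nat.ceil_lt_add_one (by linarith : 0 ≤ r)]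
  have hM2 : 2 ≤ M := by
    have : (2 : ℝ) ≤ M := by linarith
    exact_mod_cast this
  obtain ⟨S, -, T, -, hfull, hS, hT⟩ := exists_full_rectangle (fun i j => A i j = 1) Finset.univ
    Finset.univ u v hM2 (fun i _ => by linarith [hu i]) (fun j _ => by linarith [hv j])
    (fun i _ j _ => by
      rw [huv]
      rcases hA i j with h | h <;> simp [h])
  have hsum : ∑ i, (Finset.univ.filter fun j => A i j = 1).card = numOnes A :=
    (numOnes_eq_sum A).symm
  have hbound := two_pow_le_two_rpow hlam1 hMle
  have hDpos : (0 : ℝ) < 2 ^ ((2 : ℝ) ^ (36 * lam)) := by positivity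
  have hmpos : (0 : ℝ) < m := by exact_mod_cast i₀.pos
  have hnpos : (0 : ℝ) < n := by exact_mod_cast j₀.pos
  refine ⟨S, T, hfull, ?_, ?_⟩
  · rw [div_le_iff₀ hnpos]
    beta_reduce
    rw [one_div, inv_mul_le_iff₀ hDpos]
    calc (numOnes A : ℝ) ≤ 2 ^ (4000 * M ^ 6) * (S.card * n) := by
          convert hS using 2
          · rw [← hsum]
          · simp
      _ ≤ _ := by gcongr
  · rw [div_le_iff₀ hmpos]
    beta_reduce
    rw [one_div, inv_mul_le_iff₀ hDpos]
    calc (numOnes A : ℝ) ≤ 2 ^ (4000 * M ^ 6) * (T.card * m) := by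
          convert hT using 2
          · rw [← hsum]
          · simp
      _ ≤ _ := by gcongr
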